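/- Let $\mathcal L$ be a collection of $n$ pairwise disjoint, simple, piecewise regular ($C^1$) open curves in $\mathbb R^3$ whose $2n$ endpoints carry the labels $E=\{1,\dots,2n\}$. Let $\tau\in S_{2n}$ be its strand permutation ($i$ and $\tau(i)$ label the two endpoints of the same curve) and let $\sigma\in S_{2n}$ be a closure permutation, i.e. $\sigma^2=\mathrm{id}$ and $\sigma(i)\neq i$ for all $i\in E$. A virtual closure $(\mathcal L_\tau,\sigma)_v$ of $\mathcal L$ in $3$-space is a link in $\mathbb R^3$ obtained from $\mathcal L$ by adding, for every pair $\{i,\sigma(i)\}$, a virtual arc joining the endpoints $i$ and $\sigma(i)$. In a projection, every crossing in which a virtual arc takes part is by convention a virtual crossing, while the crossings between curves of $\mathcal L$ are classical, the over-strand being the higher one in the direction of projection. For a linkoid diagram $L_\tau$ in a plane, with strand permutation $\tau$, a closure diagram of $L_\tau$ with respect to $\sigma$ is a virtual link diagram obtained from $L_\tau$ by adding, for every pair $\{i,\sigma(i)\}$, a closure arc from $i$ to $\sigma(i)$ all of whose crossings are virtual; the virtual closure $(L_\tau,\sigma)_v$ is the virtual link represented by such a diagram, virtual links being taken up to planar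 isotopy, generalized Reidemeister moves and detour moves. Let $\vec\xi\in S^2$ be such that the projections of $\mathcal L$ and of the chosen virtual closure $(\mathcal L_\tau,\sigma)_v$ to the plane with normal vector $\vec\xi$ are regular (their only singularities are finitely many transversal double points, away from the endpoints and corners). Let $\mathcal L_{\vec\xi}$ be the linkoid diagram obtained by projecting $\mathcal L$, and let $\big((\mathcal L_\tau,\sigma)_v\big)_{\vec\xi}$ be the virtual diagram obtained by projecting $(\mathcal L_\tau,\sigma)_v$. Then $$\big((\mathcal L_\tau,\sigma)_v\big)_{\vec\xi}=\big((\mathcal L_{\vec\xi})_\tau,\sigma\big)_v .$$ That is, the diagram $\big((\mathcal L_\tau,\sigma)_v\big)_{\vec\xi}$ is a closure diagram of $(\mathcal L_{\vec\xi})_\tau$ with respect to $\sigma$, and the virtual link which it represents is the virtual closure of $(\mathcal L_{\vec\xi})_\tau$ with respect to $\sigma$: every closure diagram of $(\mathcal L_{\vec\xi})_\tau$ with respect to $\sigma$, for any choice of the closure arcs, represents this same virtual link. -/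

import Mathlib

open Set Topology

/-! ## Piecewise regular arcs -/

/-- A curve parametrized by `[0, 1]` is piecewise regular if, away from finitely many break points,
it is continuously differentiable with nowhere vanishing derivative, up to and including the
one-sided derivatives at the break points. -/
def IsPiecewiseRegular {X : Type*} [NormedAddCommGroup X] [NormedSpace ℝ X] (γ : ℝ → X) : Prop :=
  ∃ T : Finset ℝ, ∀ a b : ℝ, 0 ≤ a → a < b → b ≤ 1 → (∀ t ∈ T, t ∉ Ioo a b) →
    ContDiffOn ℝ 1 γ (Icc a b) ∧ ∀ t ∈ Icc a b, derivWithin γ (Icc a b) t ≠ 0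

/-- A fixed point free involution. -/
def IsPairing {D : Type*} (e : Equiv.Perm D) : Prop :=
  (∀ d, e (e d) = d) ∧ ∀ d, e d ≠ d

/-! A finite system of arcs is described by oriented arcs `γ d : [0, 1] → X`, indexed by `d : D`,
where `rev d` is the index of the arc `d` with the opposite orientation, so that every arc occurs
exactly twice.  The permutation `glue` tells how arcs are joined: the starting point of `d` is
joined to the starting point of `glue d`.  If `glue` is a fixed point free involution, then
the arcs fit together to closed curves; if `glue = 1`, then nothing is joined and one has a
collection of open curves. -/

/-- The parameters `(d, s)` and `(d', t)` belong to the same point of the same arc. -/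
def SameParam {D : Type*} (rev : Equiv.Perm D) (d : D) (s : ℝ) (d' : D) (t : ℝ) : Prop :=
  (d' = d ∧ t = s) ∨ (d' = rev d ∧ t = 1 - s)

/-- Piecewise regular arcs which are joined at their end points as prescribed by `glue`,
and no end point of which lies on the interior of an arc. -/
structure IsArcSystem {D X : Type*} [NormedAddCommGroup X] [NormedSpace ℝ X]
    (rev glue : Equiv.Perm D) (γ : D → ℝ → X) : Prop where
  regular : ∀ d, IsPiecewiseRegular (γ d)
  reverse : ∀ d, ∀ t ∈ Icc (0 : ℝ) 1, γ (rev d) t = γ d (1 - t)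
  joint : ∀ d d', γ d 0 = γ d' 0 ↔ d' = d ∨ d' = glue d
  ends : ∀ d d', ∀ t ∈ Ioo (0 : ℝ) 1, γ d 0 ≠ γ d' t

/-- The arcs form embedded curves. -/
structure IsEmbeddedSystem {D X : Type*} [NormedAddCommGroup X] [NormedSpace ℝ X]
    (rev glue : Equiv.Perm D) (γ : D → ℝ → X) : Prop extends IsArcSystem rev glue γ where
  inj : ∀ d d', ∀ s ∈ Ioo (0 : ℝ) 1, ∀ t ∈ Ioo (0 : ℝ) 1, γ d s = γ d' t → SameParam rev d s d' t

/-- The curves `γ` at time `s` and `δ` at time `t` have linearly independent tangent vectors. -/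
def IsTransverse {X : Type*} [NormedAddCommGroup X] [NormedSpace ℝ X]
    (γ : ℝ → X) (s : ℝ) (δ : ℝ → X) (t : ℝ) : Prop :=
  ContDiffAt ℝ 1 γ s ∧ ContDiffAt ℝ 1 δ t ∧ LinearIndependent ℝ ![deriv γ s, deriv δ t]

/-- `p` is a crossing of the arcs `d` and `d'` (`d'` may be `d` or its reverse). -/
def IsCrossing {D X : Type*} (rev : Equiv.Perm D) (γ : D → ℝ → X) (d d' : D) (p : X) : Prop :=
  ∃ s ∈ Ioo (0 : ℝ) 1, ∃ t ∈ Ioo (0 : ℝ) 1,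
    γ d s = p ∧ γ d' t = p ∧ ¬ SameParam rev d s d' t

/-- The arcs form generic curves (to be used in a plane): their only singularities are finitely
many transversal double points. -/
structure IsGenericSystem {D P : Type*} [NormedAddCommGroup P] [NormedSpace ℝ P]
    (rev glue : Equiv.Perm D) (γ : D → ℝ → P) : Prop extends IsArcSystem rev glue γ where
  transverse : ∀ d d', ∀ s ∈ Ioo (0 : ℝ) 1, ∀ t ∈ Ioo (0 : ℝ) 1, γ d s = γ d' t →
    SameParam rev d s d' t ∨ IsTransverse (γ d) s (γ d') t
  no_triple : ∀ d₁ d₂ d₃, ∀ s₁ ∈ Ioo (0 : ℝ) 1, ∀ s₂ ∈ Ioo (0 : ℝ) 1, ∀ s₃ ∈ Ioo (0 : ℝ) 1,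
    γ d₁ s₁ = γ d₂ s₂ → γ d₁ s₁ = γ d₃ s₃ →
    SameParam rev d₁ s₁ d₂ s₂ ∨ SameParam rev d₁ s₁ d₃ s₃ ∨ SameParam rev d₂ s₂ d₃ s₃
  finite : {p | ∃ d d', IsCrossing rev γ d d' p}.Finite

/-- Crossing data on generic curves.  `(p, ℓ) ∈ classical` means that `p` is a classical crossing,
and `ℓ` is the tangent line of the over-strand there; `virt` is the set of virtual crossings. -/
structure IsCrossingData {D P : Type*} [NormedAddCommGroup P] [NormedSpace ℝ P]
    (rev : Equiv.Perm D) (γ : D → ℝ → P) (classical : Set (P × Submodule ℝ P)) (virt : Set P) :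
    Prop where
  crossing_iff : ∀ p, (∃ d d', IsCrossing rev γ d d' p) ↔ (∃ ℓ, (p, ℓ) ∈ classical) ∨ p ∈ virt
  not_both : ∀ p ℓ, (p, ℓ) ∈ classical → p ∉ virt
  over_unique : ∀ p ℓ ℓ', (p, ℓ) ∈ classical → (p, ℓ') ∈ classical → ℓ = ℓ'
  over_tangent : ∀ p ℓ, (p, ℓ) ∈ classical →
    ∃ d, ∃ s ∈ Ioo (0 : ℝ) 1, γ d s = p ∧ ℓ = Submodule.span ℝ {deriv (γ d) s}

/-! ## Linkoid diagrams and virtual link diagrams -/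

/-- The strand permutations and closure permutations of the endpoint labels `1, …, 2n`. -/
abbrev ClosurePerm (n : ℕ) : Type := {σ : Equiv.Perm (Fin (2 * n)) // IsPairing σ}

/-- A linkoid diagram in the plane `P` with `n` components and labelled endpoints, whose strand
permutation is `τ`.  The component with end points labelled `i` and `τ i` is parametrized from
`i` to `τ i` by `strand i`, and in the opposite direction by `strand (τ i)`. -/
structure LinkoidDiagram (P : Type*) [NormedAddCommGroup P] [NormedSpace ℝ P] {n : ℕ}
    (τ : ClosurePerm n) where
  strand : Fin (2 * n) → ℝ → P
  classical : Set (P × Submodule ℝ P)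
  generic : IsGenericSystem τ.1 1 strand
  crossingData : IsCrossingData τ.1 strand classical ∅

/-- The closed curves `γ` trace out `carrier`, with the given crossing data. -/
structure IsPresentation {D P : Type*} [NormedAddCommGroup P] [NormedSpace ℝ P]
    (rev glue : Equiv.Perm D) (γ : D → ℝ → P)
    (carrier : Set P) (classical : Set (P × Submodule ℝ P)) (virt : Set P) : Prop where
  pairing_rev : IsPairing rev
  pairing_glue : IsPairing glue
  generic : IsGenericSystem rev glue γ
  carrier_eq : carrier = ⋃ d, γ d '' Icc 0 1
  crossingData : IsCrossingData rev γ classical virt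

/-- A virtual (knot or link) diagram in the plane `P`: the (unoriented) image of generic closed
curves, each crossing of which is marked as classical (with over/under information) or virtual. -/
structure VirtualDiagram (P : Type*) [NormedAddCommGroup P] [NormedSpace ℝ P] where
  carrier : Set P
  classical : Set (P × Submodule ℝ P)
  virt : Set P
  exists_curves : ∃ (D : Type) (_ : Finite D) (rev glue : Equiv.Perm D) (γ : D → ℝ → P),
    IsPresentation rev glue γ carrier classical virt

/-! ## Moves on virtual diagrams and virtual links -/

/-- A diffeomorphism of class `C¹`. -/
def IsC1Diffeo {X Y : Type*} [NormedAddCommGroup X] [NormedSpace ℝ X] [NormedAddCommGroup Y]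
    [NormedSpace ℝ Y] (φ : X ≃ₜ Y) : Prop :=
  ContDiff ℝ 1 φ ∧ ContDiff ℝ 1 φ.symm

/-- The image under `φ` of classical crossings with the tangent lines of their over-strands. -/
def pushClassical {X Y : Type*} [NormedAddCommGroup X] [NormedSpace ℝ X] [NormedAddCommGroup Y]
    [NormedSpace ℝ Y] (φ : X → Y) (C : Set (X × Submodule ℝ X)) : Set (Y × Submodule ℝ Y) :=
  (fun c => (φ c.1, c.2.map (fderiv ℝ φ c.1 : X →ₗ[ℝ] Y))) '' C

/-- `D'` is the image of `D` under an ambient isotopy of the plane. -/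
def IsIsotopic {P : Type*} [NormedAddCommGroup P] [NormedSpace ℝ P] (D D' : VirtualDiagram P) :
    Prop :=
  ∃ H : ℝ → P ≃ₜ P, Continuous (fun x : ℝ × P => H x.1 x.2) ∧
    (∀ t ∈ Icc (0 : ℝ) 1, IsC1Diffeo (H t)) ∧ H 0 = Homeomorph.refl P ∧
    D'.carrier = H 1 '' D.carrier ∧ D'.virt = H 1 '' D.virt ∧
    D'.classical = pushClassical (H 1) D.classical

/-- A piece of a virtual diagram in the square `[-3, 3]²`. -/
structure LocalPicture where
  carrier : Set (ℝ × ℝ)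
  classical : Set ((ℝ × ℝ) × Submodule ℝ (ℝ × ℝ))
  virt : Set (ℝ × ℝ)

/-- The square containing the local pictures. -/
def pictureBox : Set (ℝ × ℝ) := Icc (-3) 3 ×ˢ Icc (-3) 3

/-- The part of `D` in the disc `φ([-3, 3]²)` is the image under `φ` of the picture `A`. -/
structure ShowsPicture {P : Type*} [NormedAddCommGroup P] [NormedSpace ℝ P]
    (D : VirtualDiagram P) (φ : (ℝ × ℝ) ≃ₜ P) (A : LocalPicture) : Prop where
  carrier_eq : D.carrier ∩ φ '' pictureBox = φ '' A.carrier
  classical_eq : {c ∈ D.classical | c.1 ∈ φ '' pictureBox} = pushClassical φ A.classical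
  virt_eq : D.virt ∩ φ '' pictureBox = φ '' A.virt

/-- Inside a disc, `D` shows the picture `A` and `D'` shows the picture `A'`; outside of that
disc, `D` and `D'` agree. -/
def IsLocalMove {P : Type*} [NormedAddCommGroup P] [NormedSpace ℝ P] (A A' : LocalPicture)
    (D D' : VirtualDiagram P) : Prop :=
  ∃ φ : (ℝ × ℝ) ≃ₜ P, IsC1Diffeo φ ∧ ShowsPicture D φ A ∧ ShowsPicture D' φ A' ∧
    D.carrier \ φ '' pictureBox = D'.carrier \ φ '' pictureBox ∧
    {c ∈ D.classical | c.1 ∉ φ '' pictureBox} = {c ∈ D'.classical | c.1 ∉ φ '' pictureBox} ∧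
    D.virt \ φ '' pictureBox = D'.virt \ φ '' pictureBox

/-- The line through the origin spanned by `(x, y)`. -/
def dirLine (x y : ℝ) : Submodule ℝ (ℝ × ℝ) := Submodule.span ℝ {(x, y)}

/-- The horizontal strand through the centre of the square. -/
def horizontalStrand : Set (ℝ × ℝ) := segment ℝ (-3, 0) (3, 0)

/-- A strand with a kink: it crosses itself at the origin, where one passage is horizontal and the
other one is vertical. -/
def kinkStrand : Set (ℝ × ℝ) :=
  segment ℝ (-3, 0) (1, 0) ∪ segment ℝ (1, 0) (1, 1) ∪ segment ℝ (1, 1) (0, 1) ∪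
    segment ℝ (0, 1) (0, -1) ∪ segment ℝ (0, -1) (2, -1) ∪ segment ℝ (2, -1) (2, 0) ∪
    segment ℝ (2, 0) (3, 0)

/-- The strand from `(-3, a)` to `(3, a)` with a corner at `(0, b)`. -/
def bentStrand (a b : ℝ) : Set (ℝ × ℝ) := segment ℝ (-3, a) (0, b) ∪ segment ℝ (0, b) (3, a)

/-- The two diagonals of the square. -/
def diagonalStrands : Set (ℝ × ℝ) := segment ℝ (-3, -3) (3, 3) ∪ segment ℝ (-3, 3) (3, -3)

/-- The pairs of local pictures of the generalized Reidemeister moves: the classical moves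
`R1`, `R2`, `R3`, the virtual moves `V1`, `V2`, `V3` and the semi-virtual move `SV`. -/
inductive ReidemeisterPictures : LocalPicture → LocalPicture → Prop
  /-- A classical kink is removed; the over-strand is the horizontal or the vertical passage. -/
  | R1 (ℓ : Submodule ℝ (ℝ × ℝ)) (hℓ : ℓ = dirLine 1 0 ∨ ℓ = dirLine 0 1) :
      ReidemeisterPictures ⟨kinkStrand, {((0, 0), ℓ)}, ∅⟩ ⟨horizontalStrand, ∅, ∅⟩
  /-- A virtual kink is removed. -/
  | V1 : ReidemeisterPictures ⟨kinkStrand, ∅, {(0, 0)}⟩ ⟨horizontalStrand, ∅, ∅⟩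
  /-- The horizontal strand passes over the bent strand twice. -/
  | R2_over : ReidemeisterPictures
      ⟨horizontalStrand ∪ bentStrand 2 (-1), {((-1, 0), dirLine 1 0), ((1, 0), dirLine 1 0)}, ∅⟩
      ⟨horizontalStrand ∪ bentStrand 2 1, ∅, ∅⟩
  /-- The bent strand passes over the horizontal strand twice. -/
  | R2_under : ReidemeisterPictures
      ⟨horizontalStrand ∪ bentStrand 2 (-1),
        {((-1, 0), dirLine 1 (-1)), ((1, 0), dirLine 1 1)}, ∅⟩
      ⟨horizontalStrand ∪ bentStrand 2 1, ∅, ∅⟩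
  | V2 : ReidemeisterPictures
      ⟨horizontalStrand ∪ bentStrand 2 (-1), ∅, {(-1, 0), (1, 0)}⟩
      ⟨horizontalStrand ∪ bentStrand 2 1, ∅, ∅⟩
  /-- The bent strand is moved across the crossing of the two diagonals.  The three strands lie at
  pairwise different levels `a` (rising diagonal), `b` (falling diagonal), `c` (bent strand). -/
  | R3 (a b c : ℕ) (hab : a ≠ b) (hac : a ≠ c) (hbc : b ≠ c) : ReidemeisterPictures
      ⟨diagonalStrands ∪ bentStrand 0 (3 / 2),
        {((0, 0), if b < a then dirLine 1 1 else dirLine 1 (-1)),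
          ((1, 1), if c < a then dirLine 1 1 else dirLine 2 (-1)),
          ((-1, 1), if c < b then dirLine 1 (-1) else dirLine 2 1)}, ∅⟩
      ⟨diagonalStrands ∪ bentStrand 0 (-(3 / 2)),
        {((0, 0), if b < a then dirLine 1 1 else dirLine 1 (-1)),
          ((-1, -1), if c < a then dirLine 1 1 else dirLine 2 (-1)),
          ((1, -1), if c < b then dirLine 1 (-1) else dirLine 2 1)}, ∅⟩
  | V3 : ReidemeisterPictures
      ⟨diagonalStrands ∪ bentStrand 0 (3 / 2), ∅, {(0, 0), (1, 1), (-1, 1)}⟩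
      ⟨diagonalStrands ∪ bentStrand 0 (-(3 / 2)), ∅, {(0, 0), (-1, -1), (1, -1)}⟩
  /-- A strand with virtual crossings is moved across a classical crossing. -/
  | SV (ℓ : Submodule ℝ (ℝ × ℝ)) (hℓ : ℓ = dirLine 1 1 ∨ ℓ = dirLine 1 (-1)) :
      ReidemeisterPictures
      ⟨diagonalStrands ∪ bentStrand 0 (3 / 2), {((0, 0), ℓ)}, {(1, 1), (-1, 1)}⟩
      ⟨diagonalStrands ∪ bentStrand 0 (-(3 / 2)), {((0, 0), ℓ)}, {(-1, -1), (1, -1)}⟩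

/-- A detour move: one arc `d₀` of `D`, without classical crossings, is excised and replaced by
another arc with the same end points, all of whose crossings are again virtual.  Nothing else is
changed. -/
def IsDetour {P : Type*} [NormedAddCommGroup P] [NormedSpace ℝ P] (D D' : VirtualDiagram P) :
    Prop :=
  ∃ (A : Type) (_ : Finite A) (rev glue : Equiv.Perm A) (γ γ' : A → ℝ → P) (d₀ : A),
    IsPresentation rev glue γ D.carrier D.classical D.virt ∧
    IsPresentation rev glue γ' D'.carrier D'.classical D'.virt ∧
    (∀ d, d ≠ d₀ → d ≠ rev d₀ → ∀ t ∈ Icc (0 : ℝ) 1, γ' d t = γ d t) ∧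
    γ' d₀ 0 = γ d₀ 0 ∧ γ' d₀ 1 = γ d₀ 1 ∧
    D'.classical = D.classical ∧
    (∀ d p, IsCrossing rev γ d₀ d p → p ∈ D.virt) ∧
    (∀ d p, IsCrossing rev γ' d₀ d p → p ∈ D'.virt)

/-- The moves which generate the equivalence of virtual diagrams. -/
inductive VirtualMove {P : Type*} [NormedAddCommGroup P] [NormedSpace ℝ P] :
    VirtualDiagram P → VirtualDiagram P → Prop
  | isotopy {D D'} (h : IsIsotopic D D') : VirtualMove D D'
  | reidemeister {D D'} (A A' : LocalPicture) (hA : ReidemeisterPictures A A')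
      (h : IsLocalMove A A' D D') : VirtualMove D D'
  | detour {D D'} (h : IsDetour D D') : VirtualMove D D'

/-- Virtual knots and links: virtual diagrams up to the equivalence relation generated by
the moves. -/
def VirtualLink (P : Type*) [NormedAddCommGroup P] [NormedSpace ℝ P] : Type _ :=
  Quot (VirtualMove (P := P))

/-- The virtual link represented by a diagram. -/
def VirtualDiagram.link {P : Type*} [NormedAddCommGroup P] [NormedSpace ℝ P]
    (D : VirtualDiagram P) : VirtualLink P :=
  Quot.mk _ D

/-! ## The virtual closure of a linkoid diagram -/

/-- The orientation reversal for `n` strands with strand permutation `τ`, together with `n`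
closure arcs with closure permutation `σ`. -/
abbrev closureRev {n : ℕ} (τ σ : ClosurePerm n) : Equiv.Perm (Fin (2 * n) ⊕ Fin (2 * n)) :=
  Equiv.Perm.sumCongr τ.1 σ.1

/-- The strand and the closure arc which start at `i` are joined there. -/
abbrev closureGlue (n : ℕ) : Equiv.Perm (Fin (2 * n) ⊕ Fin (2 * n)) :=
  Equiv.sumComm _ _

/-- The diagram `D` is obtained from the linkoid diagram `L` by introducing, for every `i`, a
closure arc from `i` to `σ i` (the arc for `σ i` being the same arc with the opposite orientation)
all of whose crossings are virtual. -/
def LinkoidDiagram.IsClosureDiagram {P : Type*} [NormedAddCommGroup P] [NormedSpace ℝ P] {n : ℕ}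
    {τ : ClosurePerm n} (L : LinkoidDiagram P τ) (σ : ClosurePerm n) (D : VirtualDiagram P) :
    Prop :=
  ∃ arc : Fin (2 * n) → ℝ → P,
    IsGenericSystem (closureRev τ σ) (closureGlue n) (Sum.elim L.strand arc) ∧
    D.carrier = (⋃ i, L.strand i '' Icc 0 1) ∪ ⋃ i, arc i '' Icc 0 1 ∧
    D.classical = L.classical ∧
    D.virt = {p | ∃ i d, IsCrossing (closureRev τ σ) (Sum.elim L.strand arc) (Sum.inr i) d p}

/-- `V` is the virtual closure of `L` with respect to `σ`: it is the virtual link which is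
obtained by introducing closure arcs, whatever the choice of these arcs. -/
def LinkoidDiagram.IsVirtualClosure {P : Type*} [NormedAddCommGroup P] [NormedSpace ℝ P] {n : ℕ}
    {τ : ClosurePerm n} (L : LinkoidDiagram P τ) (σ : ClosurePerm n) (V : VirtualLink P) : Prop :=
  (∃ D, L.IsClosureDiagram σ D ∧ D.link = V) ∧ ∀ D, L.IsClosureDiagram σ D → D.link = V

/-! ## Auxiliary facts about crossings -/

theorem SameParam.symm {D : Type*} {rev : Equiv.Perm D} (hr : IsPairing rev) {d d' : D} {s t : ℝ}
    (h : SameParam rev d s d' t) : SameParam rev d' t d s := by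
  rcases h with ⟨rfl, rfl⟩ | ⟨rfl, rfl⟩
  · exact Or.inl ⟨rfl, rfl⟩
  · exact Or.inr ⟨(hr.1 d).symm, by ring⟩

theorem SameParam.apply_eq {D X : Type*} {rev : Equiv.Perm D} {γ : D → ℝ → X}
    (hγ : ∀ d, ∀ t ∈ Icc (0 : ℝ) 1, γ (rev d) t = γ d (1 - t)) {d d' : D} {s t : ℝ}
    (hs : s ∈ Ioo (0 : ℝ) 1) (h : SameParam rev d s d' t) : γ d' t = γ d s := by
  rcases h with ⟨rfl, rfl⟩ | ⟨rfl, rfl⟩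
  · rfl
  · rw [hγ d (1 - s) ⟨by linarith [hs.2], by linarith [hs.1]⟩]
    congr 1
    ring

theorem SameParam.span_deriv {D X : Type*} [NormedAddCommGroup X] [NormedSpace ℝ X]
    {rev : Equiv.Perm D} {γ : D → ℝ → X}
    (hγ : ∀ d, ∀ t ∈ Icc (0 : ℝ) 1, γ (rev d) t = γ d (1 - t)) {d d' : D} {s t : ℝ}
    (hs : s ∈ Ioo (0 : ℝ) 1) (h : SameParam rev d s d' t) :
    Submodule.span ℝ {deriv (γ d') t} = Submodule.span ℝ {deriv (γ d) s} := by
  rcases h with ⟨rfl, rfl⟩ | ⟨rfl, rfl⟩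
  · rfl
  · have hmem : Icc (0 : ℝ) 1 ∈ 𝓝 (1 - s) :=
      Icc_mem_nhds (by linarith [hs.2]) (by linarith [hs.1])
    have he : γ (rev d) =ᶠ[𝓝 (1 - s)] fun t => γ d (1 - t) := by
      filter_upwards [hmem] with t ht using hγ d t ht
    rw [he.deriv_eq, deriv_comp_const_sub (f := γ d)]
    rw [show (1 : ℝ) - (1 - s) = s by ring, ← Set.neg_singleton, Submodule.span_neg]

/-! ## Open curves in space -/

/-- Euclidean 3-space. -/
abbrev Space : Type := EuclideanSpace ℝ (Fin 3)

/-- Directions of projection. -/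
abbrev Direction : Type := Metric.sphere (0 : Space) 1

/-- The plane with normal vector `ξ`. -/
noncomputable abbrev normalPlane (ξ : Direction) : Submodule ℝ Space := (Submodule.span ℝ {(ξ : Space)})ᗮ

/-- The orthogonal projection along `ξ`. -/
noncomputable def projAlong (ξ : Direction) (x : Space) : normalPlane ξ :=
  (normalPlane ξ).orthogonalProjectionOnto x

/-- The height above the plane with normal vector `ξ`. -/
noncomputable def heightAlong (ξ : Direction) (x : Space) : ℝ := inner ℝ (ξ : Space) x

theorem eq_of_proj_of_height (ξ : Direction) {x y : Space} (h : projAlong ξ x = projAlong ξ y)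
    (h' : heightAlong ξ x = heightAlong ξ y) : x = y := by
  have h1 : x - y ∈ Submodule.span ℝ {(ξ : Space)} := by
    have : (normalPlane ξ).orthogonalProjectionOnto (x - y) = 0 := by
      rw [map_sub, sub_eq_zero]; exact h
    rw [Submodule.orthogonalProjectionOnto_eq_zero_iff, Submodule.orthogonal_orthogonal] at this
    exact this
  have h2 : x - y ∈ (Submodule.span ℝ {(ξ : Space)})ᗮ := by
    rw [Submodule.mem_orthogonal_singleton_iff_inner_right, inner_sub_right, sub_eq_zero]
    exact h'
  have h3 := Submodule.inner_right_of_mem_orthogonal h1 h2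
  exact sub_eq_zero.1 (inner_self_eq_zero.1 h3)

/-- A collection of `n` disjoint open curves in space with labelled endpoints, whose strand
permutation is `τ`.  The curve with end points labelled `i` and `τ i` is parametrized from `i` to
`τ i` by `strand i`, and in the opposite direction by `strand (τ i)`. -/
structure OpenCurves {n : ℕ} (τ : ClosurePerm n) where
  strand : Fin (2 * n) → ℝ → Space
  embedded : IsEmbeddedSystem τ.1 1 strand

/-- The projection along `ξ` is regular. -/
def OpenCurves.IsRegular {n : ℕ} {τ : ClosurePerm n} (L : OpenCurves τ) (ξ : Direction) : Prop :=
  IsGenericSystem τ.1 1 (fun i t => projAlong ξ (L.strand i t))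

/-- The crossings in the projection along `ξ`; the over-strand is the one with the larger
height. -/
def OpenCurves.projClassical {n : ℕ} {τ : ClosurePerm n} (L : OpenCurves τ) (ξ : Direction) :
    Set (normalPlane ξ × Submodule ℝ (normalPlane ξ)) :=
  {c | ∃ i j, ∃ s ∈ Ioo (0 : ℝ) 1, ∃ t ∈ Ioo (0 : ℝ) 1,
    projAlong ξ (L.strand i s) = c.1 ∧ projAlong ξ (L.strand j t) = c.1 ∧
    heightAlong ξ (L.strand j t) < heightAlong ξ (L.strand i s) ∧
    c.2 = Submodule.span ℝ {deriv (fun u => projAlong ξ (L.strand i u)) s}}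

theorem OpenCurves.projClassical_crossingData {n : ℕ} {τ : ClosurePerm n} (L : OpenCurves τ)
    (ξ : Direction) (h : L.IsRegular ξ) :
    IsCrossingData τ.1 (fun i t => projAlong ξ (L.strand i t)) (L.projClassical ξ) ∅ := by
  have hrev := L.embedded.reverse
  refine ⟨?_, fun _ _ _ => id, ?_, ?_⟩
  · intro p
    constructor
    · rintro ⟨i, j, s, hs, t, ht, hp, hq, hne⟩
      refine Or.inl ?_
      have hhe : heightAlong ξ (L.strand i s) ≠ heightAlong ξ (L.strand j t) := fun hh =>
        hne (L.embedded.inj i j s hs t ht (eq_of_proj_of_height ξ (hp.trans hq.symm) hh))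
      rcases lt_or_gt_of_ne hhe with hlt | hlt
      · exact ⟨_, j, i, t, ht, s, hs, hq, hp, hlt, rfl⟩
      · exact ⟨_, i, j, s, hs, t, ht, hp, hq, hlt, rfl⟩
    · rintro (⟨ℓ, i, j, s, hs, t, ht, hp, hq, hlt, -⟩ | hv)
      · refine ⟨i, j, s, hs, t, ht, hp, hq, fun hsame => ?_⟩
        rw [hsame.apply_eq hrev hs] at hlt
        exact lt_irrefl _ hlt
      · exact hv.elim
  · rintro p ℓ ℓ' ⟨i, j, s, hs, t, ht, hp, hq, hlt, hℓ⟩ ⟨i', j', s', hs', t', ht', hp', hq', hlt', hℓ'⟩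
    simp only at hℓ hℓ' hp hq hp' hq'
    rw [hℓ, hℓ']
    have no1 : ¬ SameParam τ.1 i s j t := fun hsame => by
      rw [hsame.apply_eq hrev hs] at hlt
      exact lt_irrefl _ hlt
    have no2 : ¬ SameParam τ.1 i' s' j' t' := fun hsame => by
      rw [hsame.apply_eq hrev hs'] at hlt'
      exact lt_irrefl _ hlt'
    rcases h.no_triple i j i' s hs t ht s' hs' (hp.trans hq.symm) (hp.trans hp'.symm) with
      hc | hc | hc
    · exact (no1 hc).elim
    · exact (hc.span_deriv (γ := fun i t => projAlong ξ (L.strand i t)) h.reverse hs).symm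
    · rcases h.no_triple i j j' s hs t ht t' ht' (hp.trans hq.symm) (hp.trans hq'.symm) with
        hd | hd | hd
      · exact (no1 hd).elim
      · rw [hc.apply_eq hrev ht, hd.apply_eq hrev hs] at hlt'
        exact (lt_asymm hlt hlt').elim
      · rw [hc.apply_eq hrev ht, hd.apply_eq hrev ht] at hlt'
        exact (lt_irrefl _ hlt').elim
  · rintro p ℓ ⟨i, j, s, hs, t, ht, hp, hq, hlt, hℓ⟩
    exact ⟨i, s, hs, hp, hℓ⟩

/-- The linkoid diagram which is obtained by a regular projection along `ξ`. -/
noncomputable def OpenCurves.projection {n : ℕ} {τ : ClosurePerm n} (L : OpenCurves τ) (ξ : Direction)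
    (h : L.IsRegular ξ) : LinkoidDiagram (normalPlane ξ) τ where
  strand i t := projAlong ξ (L.strand i t)
  classical := L.projClassical ξ
  generic := h
  crossingData := L.projClassical_crossingData ξ h

/-- A virtual closure in space of the open curves `L` with respect to `σ`: for every `i`, a virtual
closure arc from `i` to `σ i` (the arc for `σ i` being the same arc with the opposite
orientation), such that the curves and the arcs together form a link in space. -/
structure SpaceClosure {n : ℕ} {τ : ClosurePerm n} (L : OpenCurves τ) (σ : ClosurePerm n) where
  arc : Fin (2 * n) → ℝ → Space
  embedded : IsEmbeddedSystem (closureRev τ σ) (closureGlue n) (Sum.elim L.strand arc)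

namespace SpaceClosure

variable {n : ℕ} {τ σ : ClosurePerm n} {L : OpenCurves τ}

/-- The projections along `ξ` of the curves and of the virtual arcs. -/
noncomputable def projCurve (K : SpaceClosure L σ) (ξ : Direction) :
    Fin (2 * n) ⊕ Fin (2 * n) → ℝ → normalPlane ξ :=
  fun d t => projAlong ξ (Sum.elim L.strand K.arc d t)

/-- The projection along `ξ` is regular. -/
def IsRegular (K : SpaceClosure L σ) (ξ : Direction) : Prop :=
  IsGenericSystem (closureRev τ σ) (closureGlue n) (K.projCurve ξ)

theorem sameParam_inl_iff {i j : Fin (2 * n)} {s t : ℝ} :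
    SameParam (closureRev τ σ) (Sum.inl i) s (Sum.inl j) t ↔ SameParam τ.1 i s j t := by
  simp [SameParam]

theorem isCrossing_inl_iff (K : SpaceClosure L σ) (ξ : Direction) {i j : Fin (2 * n)}
    {p : normalPlane ξ} :
    IsCrossing (closureRev τ σ) (K.projCurve ξ) (Sum.inl i) (Sum.inl j) p ↔
      IsCrossing τ.1 (fun i t => projAlong ξ (L.strand i t)) i j p := by
  simp only [IsCrossing, sameParam_inl_iff, projCurve, Sum.elim_inl]

theorem IsRegular.strands {K : SpaceClosure L σ} {ξ : Direction} (h : K.IsRegular ξ) :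
    L.IsRegular ξ where
  regular i := h.regular (Sum.inl i)
  reverse i := h.reverse (Sum.inl i)
  joint i j := by
    have := h.joint (Sum.inl i) (Sum.inl j)
    simpa [projCurve] using this
  ends i j := h.ends (Sum.inl i) (Sum.inl j)
  transverse i j s hs t ht he := by
    have := h.transverse (Sum.inl i) (Sum.inl j) s hs t ht he
    rwa [sameParam_inl_iff] at this
  no_triple i j k s hs t ht u hu h1 h2 := by
    have := h.no_triple (Sum.inl i) (Sum.inl j) (Sum.inl k) s hs t ht u hu h1 h2
    rwa [sameParam_inl_iff, sameParam_inl_iff, sameParam_inl_iff] at this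
  finite := h.finite.subset (by
    rintro p ⟨i, j, hp⟩
    exact ⟨Sum.inl i, Sum.inl j, (K.isCrossing_inl_iff ξ).2 hp⟩)

theorem pairing_closureRev (τ σ : ClosurePerm n) : IsPairing (closureRev τ σ) := by
  refine ⟨?_, ?_⟩
  · rintro (i | i)
    · simp [τ.2.1 i]
    · simp [σ.2.1 i]
  · rintro (i | i)
    · simpa using τ.2.2 i
    · simpa using σ.2.2 i

theorem pairing_closureGlue (n : ℕ) : IsPairing (closureGlue n) := by
  refine ⟨?_, ?_⟩ <;> rintro (i | i) <;> simp

theorem projection_crossingData (K : SpaceClosure L σ) (ξ : Direction) (h : K.IsRegular ξ) :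
    IsCrossingData (closureRev τ σ) (K.projCurve ξ) (L.projClassical ξ)
      {p | ∃ i d, IsCrossing (closureRev τ σ) (K.projCurve ξ) (Sum.inr i) d p} := by
  have hL := L.projClassical_crossingData ξ h.strands
  refine ⟨?_, ?_, hL.over_unique, ?_⟩
  · intro p
    have hp := hL.crossing_iff p
    simp only [mem_empty_iff_false, or_false] at hp
    rw [← hp]
    constructor
    · rintro ⟨i | i, j | j, hc⟩
      · exact Or.inl ⟨i, j, (K.isCrossing_inl_iff ξ).1 hc⟩
      · obtain ⟨s, hs, t, ht, h1, h2, h3⟩ := hc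
        exact Or.inr ⟨j, Sum.inl i, t, ht, s, hs, h2, h1,
          fun h4 => h3 (h4.symm (pairing_closureRev τ σ))⟩
      · exact Or.inr ⟨i, _, hc⟩
      · exact Or.inr ⟨i, _, hc⟩
    · rintro (⟨i, j, hc⟩ | ⟨i, d, hc⟩)
      · exact ⟨_, _, (K.isCrossing_inl_iff ξ).2 hc⟩
      · exact ⟨_, _, hc⟩
  · rintro p ℓ hc ⟨k, -, u, hu, -, -, h3, -, -⟩
    obtain ⟨i, j, s, hs, t, ht, h1, h2, hne⟩ := (hL.crossing_iff p).2 (Or.inl ⟨ℓ, hc⟩)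
    rcases h.no_triple (Sum.inl i) (Sum.inl j) (Sum.inr k) s hs t ht u hu (h1.trans h2.symm)
      (h1.trans h3.symm) with hd | hd | hd
    · exact hne (sameParam_inl_iff.1 hd)
    · simp [SameParam] at hd
    · simp [SameParam] at hd
  · intro p ℓ hc
    obtain ⟨i, s, hs, h1, h2⟩ := hL.over_tangent p ℓ hc
    exact ⟨Sum.inl i, s, hs, h1, h2⟩

/-- The virtual diagram which is obtained by a regular projection along `ξ`: the crossings between
curves of `L` are classical, where the over-strand is the one with the larger height, and all
crossings which involve a virtual arc are virtual. -/
noncomputable def projection (K : SpaceClosure L σ) (ξ : Direction) (h : K.IsRegular ξ) :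
    VirtualDiagram (normalPlane ξ) where
  carrier := ⋃ d, K.projCurve ξ d '' Icc 0 1
  classical := L.projClassical ξ
  virt := {p | ∃ i d, IsCrossing (closureRev τ σ) (K.projCurve ξ) (Sum.inr i) d p}
  exists_curves := ⟨Fin (2 * n) ⊕ Fin (2 * n), inferInstance, closureRev τ σ, closureGlue n,
    K.projCurve ξ, pairing_closureRev τ σ, pairing_closureGlue n, h, rfl,
    K.projection_crossingData ξ h⟩

end SpaceClosure

/-!
Let two closure diagrams of the same linkoid diagram be given, and consider a label `i`.  The
closure arcs for `i` in the two diagrams have the same end points.  For almost every point `m` of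
the plane, the broken arc with corner `m` and these end points is in general position to both
diagrams: it has to avoid finitely many points, and a tangency of one of its legs to a curve makes
`m` a critical value of the cone over this curve, so that Sard's lemma applies.  Two detour moves
therefore replace both closure arcs for `i` by one common broken arc.  After doing this for all
labels the two diagrams coincide.
-/

section AffineLines

variable {k V : Type*} [Field k] [AddCommGroup V] [Module k V] {p q m x : V}

theorem mem_affineSpan_pair_iff_sub_mem_span :
    x ∈ line[k, p, m] ↔ x - p ∈ Submodule.span k {m - p} := by
  rw [← AffineSubspace.vsub_right_mem_direction_iff_mem (left_mem_affineSpan_pair k p m),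
    direction_affineSpan, vectorSpan_pair_rev, vsub_eq_sub, vsub_eq_sub]

theorem mem_affineSpan_pair_exchange (hx : x ∈ line[k, p, m]) (hxp : x ≠ p) :
    m ∈ line[k, p, x] :=
  (collinear_insert_of_mem_affineSpan_pair hx).mem_affineSpan_of_mem_of_ne
    (by simp) (by simp) (by simp) hxp.symm

theorem linearIndependent_sub_of_notMem_affineSpan_pair (hpq : p ≠ q)
    (hm : m ∉ line[k, p, q]) : LinearIndependent k ![p - m, q - m] := by
  have hmp : p - m ≠ 0 := fun h => hm (sub_eq_zero.1 h ▸ left_mem_affineSpan_pair k p q)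
  rw [LinearIndependent.pair_iff' hmp]
  intro a ha
  have hq : q ∈ line[k, m, p] :=
    mem_affineSpan_pair_iff_sub_mem_span.2 (Submodule.mem_span_singleton.2 ⟨a, ha⟩)
  exact hm ((collinear_insert_of_mem_affineSpan_pair hq).mem_affineSpan_of_mem_of_ne
    (by simp) (by simp) (by simp) hpq)

end AffineLines

section NullSets

open MeasureTheory Module

variable {E P : Type*} [NormedAddCommGroup E] [NormedSpace ℝ E] [FiniteDimensional ℝ E]
  [NormedAddCommGroup P] [NormedSpace ℝ P] [MeasurableSpace P] [BorelSpace P]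
  (μ : Measure P) [μ.IsAddHaarMeasure]

theorem addHaar_image_eq_zero_of_not_surjective_fderivWithin [FiniteDimensional ℝ P]
    (hEP : finrank ℝ E ≤ finrank ℝ P) {f : E → P} {f' : E → E →L[ℝ] P} {s : Set E}
    (hf : ∀ x ∈ s, HasFDerivWithinAt f (f' x) s x) (hs : ∀ x ∈ s, ¬ Function.Surjective (f' x)) :
    μ (f '' s) = 0 := by
  obtain ⟨i, hi⟩ := finrank_le_iff_exists_linearMap.1 hEP
  obtain ⟨π₀, hπ₀⟩ := i.exists_leftInverse_of_injective (LinearMap.ker_eq_bot.2 hi)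
  let π : P →L[ℝ] E := LinearMap.toContinuousLinearMap π₀
  have hπ : Function.Surjective π := fun x => ⟨i x, LinearMap.congr_fun hπ₀ x⟩
  rw [← image_preimage_eq s hπ, ← image_comp]
  refine addHaar_image_eq_zero_of_det_fderivWithin_eq_zero μ
    (f' := fun y => (f' (π y)).comp π)
    (fun y hy => (hf (π y) hy).comp y π.hasFDerivWithinAt (mapsTo_preimage π s)) fun y hy => ?_
  by_contra hdet
  have hsurj : Function.Surjective ((f' (π y)).comp π) :=
    (LinearMap.equivOfDetNeZero _ hdet).surjective
  exact hs (π y) hy (hsurj.of_comp (g := π))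

variable {μ}

theorem ae_notMem_affineSpan_pair (hP : 1 < finrank ℝ P) (p q : P) :
    ∀ᵐ m ∂μ, m ∉ line[ℝ, p, q] := by
  have : FiniteDimensional ℝ P := .of_finrank_pos (zero_lt_one.trans hP)
  have htop : line[ℝ, p, q] ≠ ⊤ := fun h => by
    have hle := collinear_iff_finrank_le_one.1 (collinear_pair ℝ p q)
    rw [← direction_affineSpan, h, AffineSubspace.direction_top, finrank_top] at hle
    exact hle.not_gt hP
  exact compl_mem_ae_iff.2 (Measure.addHaar_affineSubspace μ _ htop)

theorem ae_linearIndependent_deriv_of_mem_affineSpan_pair (hP : 1 < finrank ℝ P) (p : P)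
    {γ γ' : ℝ → P} {U : Set ℝ} (hγ : ∀ t ∈ U, HasDerivAt γ (γ' t) t) :
    ∀ᵐ m ∂μ, ∀ t ∈ U, γ t ≠ p → γ t ∈ line[ℝ, p, m] → LinearIndependent ℝ ![m - p, γ' t] := by
  have : FiniteDimensional ℝ P := .of_finrank_pos (zero_lt_one.trans hP)
  -- If `γ t` lies on the line through `p` and `m`, then `m` is a value of the cone over `γ` with
  -- apex `p`, and it is a critical value if `γ` is tangent to this line at `t`.
  let cone : ℝ × ℝ → P := fun y => y.2 • (γ y.1 - p) + p
  let cone' : ℝ × ℝ → ℝ × ℝ →L[ℝ] P := fun y =>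
    (ContinuousLinearMap.fst ℝ ℝ ℝ).smulRight (y.2 • γ' y.1) +
      (ContinuousLinearMap.snd ℝ ℝ ℝ).smulRight (γ y.1 - p)
  let s : Set (ℝ × ℝ) := {y | y.1 ∈ U ∧ ¬ LinearIndependent ℝ ![γ y.1 - p, y.2 • γ' y.1]}
  have hcone : ∀ y ∈ s, HasFDerivWithinAt cone (cone' y) s y := fun y hy => by
    have hγy : HasFDerivAt (fun y : ℝ × ℝ => γ y.1 - p) _ y :=
      ((hγ y.1 hy.1).hasFDerivAt.comp y (hasFDerivAt_fst (𝕜 := ℝ))).sub_const p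
    refine (((hasFDerivAt_snd.smul hγy).add_const p).congr_fderiv ?_).hasFDerivWithinAt
    ext <;> simp [cone']
  have hcrit : ∀ y ∈ s, ¬ Function.Surjective (cone' y) := fun y hy hsurj => by
    refine hy.2 (linearIndependent_iff_card_le_finrank_span.2 ?_)
    have hspan : Submodule.span ℝ (range ![γ y.1 - p, y.2 • γ' y.1]) = ⊤ := by
      refine eq_top_iff.2 fun z _ => ?_
      obtain ⟨a, rfl⟩ := hsurj z
      simp only [Matrix.range_cons, Matrix.range_empty, union_empty, singleton_union]
      exact Submodule.mem_span_pair.2 ⟨a.2, a.1, add_comm _ _⟩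
    rw [Set.finrank, hspan, finrank_top, Fintype.card_fin]
    exact hP
  have hnull := addHaar_image_eq_zero_of_not_surjective_fderivWithin μ
    (by simp [Nat.succ_le_iff, hP]) hcone hcrit
  filter_upwards [compl_mem_ae_iff.2 hnull] with m hm t ht htp hline
  obtain ⟨r, hr⟩ := Submodule.mem_span_singleton.1 <|
    mem_affineSpan_pair_iff_sub_mem_span.1 (mem_affineSpan_pair_exchange hline htp)
  by_contra hdep
  refine hm ⟨(t, r), ⟨ht, fun hind => hdep ?_⟩, by simp [cone, hr]⟩
  have hr0 : r ≠ 0 := fun hr0 => hind.ne_zero 1 (by simp [hr0])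
  rw [← one_smul ℝ (γ t - p), LinearIndependent.pair_smul_smul_iff isUnit_one hr0.isUnit] at hind
  rwa [← hr, ← one_smul ℝ (γ' t), LinearIndependent.pair_smul_smul_iff hr0.isUnit isUnit_one]

theorem ae_notMem_image_of_hasDerivAt (hP : 1 < finrank ℝ P) {γ γ' : ℝ → P} {U : Set ℝ}
    (hγ : ∀ t ∈ U, HasDerivAt γ (γ' t) t) : ∀ᵐ m ∂μ, m ∉ γ '' U := by
  have : FiniteDimensional ℝ P := .of_finrank_pos (zero_lt_one.trans hP)
  refine compl_mem_ae_iff.2 (addHaar_image_eq_zero_of_not_surjective_fderivWithin μ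
    (by simpa using hP.le) (fun t ht => (hγ t ht).hasFDerivAt.hasFDerivWithinAt) fun t _ h => ?_)
  have hle := LinearMap.finrank_le_finrank_of_surjective (f := (_ : ℝ →L[ℝ] P).toLinearMap) h
  rw [finrank_self] at hle
  exact hle.not_gt hP

end NullSets


section PiecewiseRegular

variable {X : Type*} [NormedAddCommGroup X] [NormedSpace ℝ X] {γ : ℝ → X}

theorem IsPiecewiseRegular.reverse (h : IsPiecewiseRegular γ) :
    IsPiecewiseRegular fun t => γ (1 - t) := by
  obtain ⟨T, hT⟩ := h
  refine ⟨T.image (1 - ·), fun a b ha hab hb hbreak => ?_⟩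
  obtain ⟨hC, hv⟩ := hT (1 - b) (1 - a) (by linarith) (by linarith) (by linarith) fun t ht hmem =>
    hbreak (1 - t) (Finset.mem_image_of_mem _ ht) ⟨by linarith [hmem.2], by linarith [hmem.1]⟩
  have hmaps : MapsTo (1 - ·) (Icc a b) (Icc (1 - b) (1 - a)) := fun t ht =>
    ⟨by linarith [ht.2], by linarith [ht.1]⟩
  refine ⟨hC.comp (contDiff_const.sub contDiff_id).contDiffOn hmaps, fun t ht => ?_⟩
  have hd : HasDerivWithinAt (fun t => γ (1 - t)) _ (Icc a b) t :=
    (hC.differentiableOn one_ne_zero _ (hmaps ht)).hasDerivWithinAt.scomp t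
      ((hasDerivWithinAt_id t _).const_sub 1) hmaps
  rw [hd.derivWithin (uniqueDiffOn_Icc hab t ht)]
  exact smul_ne_zero (by norm_num) (hv _ (hmaps ht))

theorem IsPiecewiseRegular.exists_hasDerivWithinAt_right (h : IsPiecewiseRegular γ) {t : ℝ}
    (ht : t ∈ Ico (0 : ℝ) 1) : ∃ v ≠ 0, HasDerivWithinAt γ v (Icc t 1) t := by
  obtain ⟨T, hT⟩ := h
  have hbreak : ∀ᶠ b in 𝓝[>] t, ∀ s ∈ T, s ∉ Ioo t b := by
    rw [Filter.eventually_all_finset]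
    intro s _
    rcases le_or_gt s t with hs | hs
    · exact Filter.Eventually.of_forall fun b hb => absurd hb.1 (not_lt.2 hs)
    · filter_upwards [Ioo_mem_nhdsGT hs] with b hb hsb using lt_asymm hb.2 hsb.2
  obtain ⟨b, hb, htb, hb1⟩ := (hbreak.and (Ioo_mem_nhdsGT ht.2)).exists
  obtain ⟨hC, hv⟩ := hT t b ht.1 htb hb1.le hb
  have hmem : t ∈ Icc t b := left_mem_Icc.2 htb.le
  refine ⟨_, hv t hmem,
    (hC.differentiableOn one_ne_zero t hmem).hasDerivWithinAt.mono_of_mem_nhdsWithin ?_⟩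
  filter_upwards [self_mem_nhdsWithin, mem_nhdsWithin_of_mem_nhds (Iio_mem_nhds htb)]
    with s hs hsb using ⟨hs.1, le_of_lt hsb⟩

theorem IsPiecewiseRegular.exists_hasDerivWithinAt_left (h : IsPiecewiseRegular γ) {t : ℝ}
    (ht : t ∈ Ioc (0 : ℝ) 1) : ∃ v ≠ 0, HasDerivWithinAt γ v (Icc 0 t) t := by
  obtain ⟨v, hv, hd⟩ := h.reverse.exists_hasDerivWithinAt_right (t := 1 - t)
    ⟨by linarith [ht.2], by linarith [ht.1]⟩
  have hmaps : MapsTo (1 - ·) (Icc 0 t) (Icc (1 - t) 1) := fun s hs =>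
    ⟨by linarith [hs.2], by linarith [hs.1]⟩
  have hd' := hd.scomp t ((hasDerivWithinAt_id t _).const_sub 1) hmaps
  exact ⟨-v, neg_ne_zero.2 hv, by simpa [Function.comp_def] using hd'⟩

theorem IsPiecewiseRegular.continuousOn (h : IsPiecewiseRegular γ) :
    ContinuousOn γ (Icc 0 1) := by
  intro t ht
  rw [← Icc_union_Icc_eq_Icc ht.1 ht.2, continuousWithinAt_union]
  constructor
  · rcases ht.1.eq_or_lt with rfl | h0
    · rw [Icc_self]; exact continuousWithinAt_singleton
    · obtain ⟨v, -, hv⟩ := h.exists_hasDerivWithinAt_left ⟨h0, ht.2⟩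
      exact hv.continuousWithinAt
  · rcases ht.2.eq_or_lt with rfl | h1
    · rw [Icc_self]; exact continuousWithinAt_singleton
    · obtain ⟨v, -, hv⟩ := h.exists_hasDerivWithinAt_right ⟨ht.1, h1⟩
      exact hv.continuousWithinAt

theorem IsPiecewiseRegular.exists_contDiffAt (h : IsPiecewiseRegular γ) :
    ∃ T : Finset ℝ, ∀ t ∈ Ioo (0 : ℝ) 1, t ∉ T → ContDiffAt ℝ 1 γ t := by
  obtain ⟨T, hT⟩ := h
  refine ⟨T, fun t ht htT => ?_⟩
  have hU : Ioo (0 : ℝ) 1 ∩ (T : Set ℝ)ᶜ ∈ 𝓝 t :=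
    Filter.inter_mem (Ioo_mem_nhds ht.1 ht.2) (T.finite_toSet.isClosed.isOpen_compl.mem_nhds htT)
  obtain ⟨a, b, -, hnhds, hsub⟩ := exists_Icc_mem_subset_of_mem_nhds hU
  have htab : t ∈ Ioo a b := Icc_mem_nhds_iff.1 hnhds
  have hab : a < b := htab.1.trans htab.2
  exact (hT a b (hsub (left_mem_Icc.2 hab.le)).1.1.le hab (hsub (right_mem_Icc.2 hab.le)).1.2.le
    fun s hs hsab => (hsub (Ioo_subset_Icc_self hsab)).2 hs).1.contDiffAt hnhds

theorem IsPiecewiseRegular.of_eqOn {f g : ℝ → X} {c : ℝ} (hf : ContDiff ℝ 1 f)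
    (hf' : ∀ t, deriv f t ≠ 0) (hg : ContDiff ℝ 1 g) (hg' : ∀ t, deriv g t ≠ 0)
    (hγf : EqOn γ f (Iic c)) (hγg : EqOn γ g (Ici c)) : IsPiecewiseRegular γ := by
  have hregular : ∀ {h : ℝ → X}, ContDiff ℝ 1 h → (∀ t, deriv h t ≠ 0) → ∀ {a b : ℝ}, a < b →
      EqOn γ h (Icc a b) →
      ContDiffOn ℝ 1 γ (Icc a b) ∧ ∀ t ∈ Icc a b, derivWithin γ (Icc a b) t ≠ 0 := by
    intro h hh hh' a b hab heq
    refine ⟨hh.contDiffOn.congr heq, fun t ht => ?_⟩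
    rw [derivWithin_congr heq (heq ht),
      (hh.differentiable one_ne_zero t).derivWithin (uniqueDiffOn_Icc hab t ht)]
    exact hh' t
  refine ⟨{c}, fun a b _ hab _ hc => ?_⟩
  rcases le_or_gt b c with hbc | hcb
  · exact hregular hf hf' hab (hγf.mono fun t ht => ht.2.trans hbc)
  · have hca : c ≤ a := not_lt.1 fun hac => hc c (Finset.mem_singleton_self c) ⟨hac, hcb⟩
    exact hregular hg hg' hab (hγg.mono fun t ht => hca.trans ht.1)

theorem IsTransverse.symm {γ δ : ℝ → X} {s t : ℝ} (h : IsTransverse γ s δ t) :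
    IsTransverse δ t γ s :=
  ⟨h.2.1, h.1, LinearIndependent.pair_symm_iff.1 h.2.2⟩

theorem IsTransverse.reverse {γ δ : ℝ → X} {s t : ℝ} (h : IsTransverse γ (1 - s) δ t) :
    IsTransverse (fun u => γ (1 - u)) s δ t := by
  refine ⟨h.1.comp s (contDiffAt_const.sub contDiffAt_id), h.2.1, ?_⟩
  rw [deriv_comp_const_sub, LinearIndependent.pair_neg_left_iff]
  exact h.2.2

end PiecewiseRegular

section MeetsLineTransversely

open MeasureTheory Module

variable {P : Type*} [NormedAddCommGroup P] [NormedSpace ℝ P] {γ : ℝ → P} {p m : P}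

/-- The arc `γ` crosses the line through `p` and `m` transversely wherever it meets it, and away
from `p` it does so only at smooth interior points of `γ`.  The arc may start or end at `p`, where
its one-sided derivative has to be transverse to the line. -/
def MeetsLineTransversely (γ : ℝ → P) (p m : P) : Prop :=
  ∀ t ∈ Icc (0 : ℝ) 1, γ t ∈ line[ℝ, p, m] →
    (γ t = p ∨ t ∈ Ioo (0 : ℝ) 1 ∧ ContDiffAt ℝ 1 γ t) ∧
      ∃ v, HasDerivWithinAt γ v (Icc 0 1) t ∧ LinearIndependent ℝ ![m - p, v]

theorem finite_setOf_eq_of_hasDerivWithinAt_ne_zero {F : Type*} [NormedAddCommGroup F]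
    [NormedSpace ℝ F] {g : ℝ → F} {K : Set ℝ} {c : F} (hK : IsCompact K) (hg : ContinuousOn g K)
    (h : ∀ t ∈ K, g t = c → ∃ v ≠ 0, HasDerivWithinAt g v K t) : {t ∈ K | g t = c}.Finite := by
  by_contra hinf
  obtain ⟨t, ht, hacc⟩ :=
    Set.Infinite.exists_accPt_of_subset_isCompact hinf hK fun _ hs => hs.1
  rw [accPt_iff_frequently_nhdsNE] at hacc
  have hisolated : ∀ᶠ s in 𝓝[≠] t, s ∈ K → g s ≠ c := by
    rw [← Filter.eventually_inf_principal, ← nhdsWithin_inter', inter_comm, ← sdiff_eq]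
    by_cases hgt : g t = c
    · obtain ⟨v, hv, hd⟩ := h t ht hgt
      exact hd.eventually_ne hv
    · exact ((hg t ht).eventually_ne hgt).filter_mono (nhdsWithin_mono t sdiff_subset)
  obtain ⟨s, hs, hs'⟩ := (hacc.and_eventually hisolated).exists
  exact hs' hs.1 hs.2

theorem MeetsLineTransversely.finite (h : MeetsLineTransversely γ p m)
    (hγ : ContinuousOn γ (Icc 0 1)) : {t ∈ Icc (0 : ℝ) 1 | γ t ∈ line[ℝ, p, m]}.Finite := by
  have : IsClosed ((ℝ ∙ (m - p) : Submodule ℝ P) : Set P) := Submodule.closed_of_finiteDimensional _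
  let π := (ℝ ∙ (m - p)).mkQL
  have hline : ∀ x, x ∈ line[ℝ, p, m] ↔ π (x - p) = 0 := fun x => by
    rw [mem_affineSpan_pair_iff_sub_mem_span, Submodule.coe_mkQL,
      Submodule.mkQ_apply, Submodule.Quotient.mk_eq_zero]
  simp only [hline]
  refine finite_setOf_eq_of_hasDerivWithinAt_ne_zero isCompact_Icc
    (π.continuous.comp_continuousOn (hγ.sub continuousOn_const)) fun t ht hzero => ?_
  obtain ⟨-, v, hd, hv⟩ := h t ht ((hline _).2 hzero)
  refine ⟨π v, fun hπv => ?_, π.hasFDerivAt.comp_hasDerivWithinAt t (hd.sub_const p)⟩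
  obtain ⟨a, ha⟩ := Submodule.mem_span_singleton.1 <|
    (Submodule.Quotient.mk_eq_zero (ℝ ∙ (m - p))).1 hπv
  exact (LinearIndependent.pair_iff' (hv.ne_zero 0)).1 hv a ha

theorem linearIndependent_of_notMem_affineSpan_pair_add {v : P} (hv : v ≠ 0)
    (hm : m ∉ line[ℝ, p, p + v]) : LinearIndependent ℝ ![m - p, v] := by
  rw [LinearIndependent.pair_symm_iff, LinearIndependent.pair_iff' hv]
  refine fun a ha => hm (mem_affineSpan_pair_iff_sub_mem_span.2 ?_)
  exact Submodule.mem_span_singleton.2 ⟨a, by rw [add_sub_cancel_left, ha]⟩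

variable [MeasurableSpace P] [BorelSpace P] {μ : Measure P} [μ.IsAddHaarMeasure]

theorem IsPiecewiseRegular.ae_meetsLineTransversely (hP : 1 < finrank ℝ P)
    (h : IsPiecewiseRegular γ) (hp : ∀ t ∈ Ioo (0 : ℝ) 1, p ≠ γ t) :
    ∀ᵐ m ∂μ, MeetsLineTransversely γ p m := by
  obtain ⟨T, hT⟩ := h.exists_contDiffAt
  obtain ⟨v₀, hv₀, hd₀⟩ := h.exists_hasDerivWithinAt_right (t := 0) (by simp)
  obtain ⟨v₁, hv₁, hd₁⟩ := h.exists_hasDerivWithinAt_left (t := 1) (by simp)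
  have hbreak : ∀ᵐ m ∂μ, ∀ t ∈ insert 0 (insert 1 T), m ∉ line[ℝ, p, γ t] := by
    rw [Filter.eventually_all_finset]
    exact fun t _ => ae_notMem_affineSpan_pair hP p (γ t)
  have hsmooth := ae_linearIndependent_deriv_of_mem_affineSpan_pair (μ := μ) hP p
    (U := Ioo 0 1 \ T) fun t ht => ((hT t ht.1 ht.2).differentiableAt one_ne_zero).hasDerivAt
  filter_upwards [hbreak, hsmooth, ae_notMem_affineSpan_pair hP p (p + v₀),
    ae_notMem_affineSpan_pair hP p (p + v₁)] with m hbreak hsmooth hm₀ hm₁ t ht hline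
  by_cases htp : γ t = p
  · refine ⟨Or.inl htp, ?_⟩
    rcases eq_endpoints_or_mem_Ioo_of_mem_Icc ht with rfl | rfl | htI
    · exact ⟨v₀, hd₀, linearIndependent_of_notMem_affineSpan_pair_add hv₀ hm₀⟩
    · exact ⟨v₁, hd₁, linearIndependent_of_notMem_affineSpan_pair_add hv₁ hm₁⟩
    · exact absurd htp.symm (hp t htI)
  · have htT : t ∉ insert 0 (insert 1 T) := fun hmem =>
      hbreak t hmem (mem_affineSpan_pair_exchange hline htp)
    simp only [Finset.mem_insert, not_or] at htT
    have htI : t ∈ Ioo (0 : ℝ) 1 :=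
      ⟨ht.1.lt_of_ne' htT.1, ht.2.lt_of_ne htT.2.1⟩
    have hC := hT t htI htT.2.2
    exact ⟨Or.inr ⟨htI, hC⟩, deriv γ t,
      (hC.differentiableAt one_ne_zero).hasDerivAt.hasDerivWithinAt,
      hsmooth t ⟨htI, htT.2.2⟩ htp hline⟩

theorem IsPiecewiseRegular.ae_notMem_image (hP : 1 < finrank ℝ P) (h : IsPiecewiseRegular γ) :
    ∀ᵐ m ∂μ, m ∉ γ '' Icc 0 1 := by
  have : FiniteDimensional ℝ P := .of_finrank_pos (zero_lt_one.trans hP)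
  have : Nontrivial P := nontrivial_of_finrank_pos (zero_lt_one.trans hP)
  obtain ⟨T, hT⟩ := h.exists_contDiffAt
  have hbreak : μ (γ '' ↑(insert 0 (insert 1 T))) = 0 :=
    ((Finset.finite_toSet _).image γ).measure_zero μ
  filter_upwards [compl_mem_ae_iff.2 hbreak, ae_notMem_image_of_hasDerivAt hP
    (U := Ioo 0 1 \ T) fun t ht => ((hT t ht.1 ht.2).differentiableAt one_ne_zero).hasDerivAt]
    with m hbreak hsmooth
  rintro ⟨t, ht, rfl⟩
  by_cases htT : t ∈ insert 0 (insert 1 T)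
  · exact hbreak (mem_image_of_mem γ htT)
  · simp only [Finset.mem_insert, not_or] at htT
    exact hsmooth (mem_image_of_mem γ
      ⟨⟨ht.1.lt_of_ne' htT.1, ht.2.lt_of_ne htT.2.1⟩, htT.2.2⟩)

end MeetsLineTransversely

section BrokenArc

variable {P : Type*} [NormedAddCommGroup P] [NormedSpace ℝ P] {p m q : P} {γ : ℝ → P} {s t : ℝ}

/-- The broken line from `p` to `q` with its corner `m` at the parameter `1 / 2`.  One of the
coefficients of `p - m` and `q - m` vanishes, so that they are coordinates on the two legs. -/
noncomputable def brokenArc (p m q : P) (t : ℝ) : P :=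
  m + ((1 - 2 * t)⁺ • (p - m) + (1 - 2 * t)⁻ • (q - m))

theorem brokenArc_swap (p m q : P) (t : ℝ) : brokenArc q m p t = brokenArc p m q (1 - t) := by
  have hneg : 1 - 2 * (1 - t) = -(1 - 2 * t) := by ring
  rw [brokenArc, brokenArc, hneg, posPart_neg, negPart_neg, add_comm (_ • (q - m))]

theorem brokenArc_of_le_half (ht : t ≤ 1 / 2) :
    brokenArc p m q t = m + (1 - 2 * t) • (p - m) := by
  have hnonneg : 0 ≤ 1 - 2 * t := by linarith
  rw [brokenArc, posPart_of_nonneg hnonneg, negPart_of_nonneg hnonneg, zero_smul, add_zero]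

theorem brokenArc_of_half_le (ht : 1 / 2 ≤ t) :
    brokenArc p m q t = m + (2 * t - 1) • (q - m) := by
  rw [← sub_sub_cancel 1 t, ← brokenArc_swap, brokenArc_of_le_half (by linarith)]
  congr 2
  ring

theorem brokenArc_zero (p m q : P) : brokenArc p m q 0 = p := by
  simp [brokenArc_of_le_half]

theorem brokenArc_one (p m q : P) : brokenArc p m q 1 = q := by
  rw [← sub_zero 1, ← brokenArc_swap, brokenArc_zero]

theorem brokenArc_half (p m q : P) : brokenArc p m q (1 / 2) = m := by
  simp [brokenArc]

theorem brokenArc_mem_affineSpan_pair_of_le_half (ht : t ≤ 1 / 2) :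
    brokenArc p m q t ∈ line[ℝ, p, m] := by
  refine mem_affineSpan_pair_iff_sub_mem_span.2 (Submodule.mem_span_singleton.2 ⟨2 * t, ?_⟩)
  rw [brokenArc_of_le_half ht]
  module

theorem brokenArc_mem_affineSpan_pair (p m q : P) (t : ℝ) :
    brokenArc p m q t ∈ line[ℝ, p, m] ∨ brokenArc p m q t ∈ line[ℝ, q, m] := by
  refine (le_total t (1 / 2)).imp brokenArc_mem_affineSpan_pair_of_le_half fun ht => ?_
  rw [← sub_sub_cancel 1 t, ← brokenArc_swap]
  exact brokenArc_mem_affineSpan_pair_of_le_half (by linarith)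

theorem brokenArc_injective (h : LinearIndependent ℝ ![p - m, q - m]) :
    Function.Injective (brokenArc p m q) := by
  intro s t hst
  obtain ⟨hpos, hneg⟩ := h.eq_of_pair (add_left_cancel hst)
  have hdiff := congrArg₂ (· - ·) hpos hneg
  simp only [posPart_sub_negPart] at hdiff
  linarith

theorem isPiecewiseRegular_brokenArc (hp : m ≠ p) (hq : m ≠ q) :
    IsPiecewiseRegular (brokenArc p m q) := by
  refine .of_eqOn (c := 1 / 2) (by fun_prop) (fun t => ?_) (by fun_prop) (fun t => ?_)
    (fun t ht => brokenArc_of_le_half ht) fun t ht => brokenArc_of_half_le ht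
  · rw [((((hasDerivAt_id' t).const_mul 2).const_sub 1).smul_const (p - m)).const_add m |>.deriv]
    exact smul_ne_zero (by norm_num) (sub_ne_zero.2 hp.symm)
  · rw [((((hasDerivAt_id' t).const_mul 2).sub_const 1).smul_const (q - m)).const_add m |>.deriv]
    exact smul_ne_zero (by norm_num) (sub_ne_zero.2 hq.symm)

theorem MeetsLineTransversely.isTransverse_brokenArc_of_lt_half
    (h : MeetsLineTransversely γ p m) (hm : m ≠ p) (hs : s ∈ Ioo 0 (1 / 2))
    (ht : t ∈ Icc (0 : ℝ) 1) (hst : brokenArc p m q s = γ t) :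
    t ∈ Ioo (0 : ℝ) 1 ∧ IsTransverse (brokenArc p m q) s γ t := by
  have hne : γ t ≠ p := by
    rw [← hst, brokenArc_of_le_half hs.2.le, ← sub_ne_zero,
      show m + (1 - 2 * s) • (p - m) - p = (2 * s) • (m - p) by module]
    exact smul_ne_zero (by linarith [hs.1]) (sub_ne_zero.2 hm)
  obtain ⟨hγ, v, hv, hind⟩ :=
    h t ht (hst ▸ brokenArc_mem_affineSpan_pair_of_le_half hs.2.le)
  obtain ⟨htI, hC⟩ := hγ.resolve_left hne
  have hleg : brokenArc p m q =ᶠ[𝓝 s] fun r => m + (1 - 2 * r) • (p - m) := by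
    filter_upwards [Iio_mem_nhds hs.2] with r hr using brokenArc_of_le_half (le_of_lt hr)
  have hderiv : deriv (brokenArc p m q) s = (2 : ℝ) • (m - p) := by
    rw [hleg.deriv_eq,
      ((((hasDerivAt_id' s).const_mul 2).const_sub 1).smul_const (p - m)).const_add m |>.deriv]
    module
  refine ⟨htI, ContDiffAt.congr_of_eventuallyEq (ContDiff.contDiffAt (by fun_prop)) hleg, hC, ?_⟩
  rw [hderiv, (hv.hasDerivAt (Icc_mem_nhds htI.1 htI.2)).deriv, ← one_smul ℝ v]
  exact (LinearIndependent.pair_smul_smul_iff (isUnit_iff_ne_zero.2 two_ne_zero) isUnit_one).2 hind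

theorem MeetsLineTransversely.isTransverse_brokenArc (hp : MeetsLineTransversely γ p m)
    (hq : MeetsLineTransversely γ q m) (hm : m ∉ γ '' Icc 0 1) (hmp : m ≠ p) (hmq : m ≠ q)
    (hs : s ∈ Ioo (0 : ℝ) 1) (ht : t ∈ Icc (0 : ℝ) 1) (hst : brokenArc p m q s = γ t) :
    t ∈ Ioo (0 : ℝ) 1 ∧ IsTransverse (brokenArc p m q) s γ t := by
  rcases lt_trichotomy s (1 / 2) with h | rfl | h
  · exact hp.isTransverse_brokenArc_of_lt_half hmp ⟨hs.1, h⟩ ht hst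
  · exact absurd ⟨t, ht, hst.symm.trans (brokenArc_half p m q)⟩ hm
  · have hswap : brokenArc p m q = fun u => brokenArc q m p (1 - u) :=
      funext (brokenArc_swap q m p)
    rw [hswap] at hst ⊢
    have hs' : 1 - s ∈ Ioo 0 (1 / 2) := ⟨by linarith [hs.2], by linarith⟩
    exact (hq.isTransverse_brokenArc_of_lt_half hmq hs' ht hst).imp_right IsTransverse.reverse

end BrokenArc

section ReplaceArc

variable {D X : Type*} {rev : Equiv.Perm D} {γ : D → ℝ → X} {d₀ d : D} {δ : ℝ → X} {t : ℝ}

theorem IsPairing.apply_mem_pair_iff (hr : IsPairing rev) :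
    rev d ∈ ({d₀, rev d₀} : Set D) ↔ d ∈ ({d₀, rev d₀} : Set D) := by
  rw [mem_insert_iff, mem_singleton_iff, mem_insert_iff, mem_singleton_iff, rev.apply_eq_iff_eq,
    or_comm, ← rev.apply_eq_iff_eq (x := d) (y := rev d₀), hr.1]

variable [DecidableEq D]

/-- The system of arcs obtained from `γ` by replacing the arc `d₀` by `δ`, and accordingly its
reverse `rev d₀` by the reverse of `δ`. -/
def replaceArc (rev : Equiv.Perm D) (γ : D → ℝ → X) (d₀ : D) (δ : ℝ → X) : D → ℝ → X :=
  Function.update (Function.update γ (rev d₀) fun t => δ (1 - t)) d₀ δ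

theorem replaceArc_self : replaceArc rev γ d₀ δ d₀ = δ :=
  Function.update_self ..

theorem replaceArc_rev (hr : IsPairing rev) :
    replaceArc rev γ d₀ δ (rev d₀) = fun t => δ (1 - t) := by
  rw [replaceArc, Function.update_of_ne (hr.2 d₀), Function.update_self]

theorem replaceArc_of_notMem (hd : d ∉ ({d₀, rev d₀} : Set D)) :
    replaceArc rev γ d₀ δ d = γ d := by
  rw [replaceArc, Function.update_of_ne fun h => hd (Or.inl h),
    Function.update_of_ne fun h => hd (Or.inr h)]

theorem image_replaceArc (hr : IsPairing rev) (hd : d ∈ ({d₀, rev d₀} : Set D)) :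
    replaceArc rev γ d₀ δ d '' Icc 0 1 = δ '' Icc 0 1 := by
  rcases hd with rfl | rfl
  · rw [replaceArc_self]
  · rw [replaceArc_rev hr, ← image_image δ (1 - ·), image_const_sub_Icc, sub_self, sub_zero]

end ReplaceArc

section IsDetourArc

variable {D P : Type*} [DecidableEq D] [NormedAddCommGroup P] [NormedSpace ℝ P]
  {rev glue : Equiv.Perm D} {γ : D → ℝ → P} {d₀ d d' d'' : D} {δ : ℝ → P} {s t u : ℝ}

/-- `δ` joins the end points of the arc `d₀` of the system `γ`, and it is in general position to
all arcs of the system, so that `δ` may replace the arc `d₀`. -/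
structure IsDetourArc (rev : Equiv.Perm D) (γ : D → ℝ → P) (d₀ : D) (δ : ℝ → P) : Prop where
  regular : IsPiecewiseRegular δ
  injOn : InjOn δ (Icc 0 1)
  zero : δ 0 = γ d₀ 0
  one : δ 1 = γ (rev d₀) 0
  transverse : ∀ d, ∀ s ∈ Ioo (0 : ℝ) 1, ∀ t ∈ Icc (0 : ℝ) 1, δ s = γ d t →
    t ∈ Ioo (0 : ℝ) 1 ∧ IsTransverse δ s (γ d) t
  not_isCrossing : ∀ d d', ∀ s ∈ Ioo (0 : ℝ) 1, ¬ IsCrossing rev γ d d' (δ s)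
  finite_inter : ∀ d, (δ '' Icc 0 1 ∩ γ d '' Icc 0 1).Finite

namespace IsDetourArc

theorem replaceArc_zero (hδ : IsDetourArc rev γ d₀ δ) (hr : IsPairing rev) (d : D) :
    replaceArc rev γ d₀ δ d 0 = γ d 0 := by
  by_cases hd : d ∈ ({d₀, rev d₀} : Set D)
  · rcases hd with rfl | rfl
    · rw [replaceArc_self, hδ.zero]
    · simp only [replaceArc_rev hr, sub_zero, hδ.one]
  · rw [replaceArc_of_notMem hd]

theorem sameParam_of_eq (hδ : IsDetourArc rev γ d₀ δ) (hr : IsPairing rev)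
    (hd : d ∈ ({d₀, rev d₀} : Set D)) (hd' : d' ∈ ({d₀, rev d₀} : Set D))
    (hs : s ∈ Icc (0 : ℝ) 1) (ht : t ∈ Icc (0 : ℝ) 1)
    (h : replaceArc rev γ d₀ δ d s = replaceArc rev γ d₀ δ d' t) : SameParam rev d s d' t := by
  have hs' := Icc.mem_iff_one_sub_mem.1 hs
  have ht' := Icc.mem_iff_one_sub_mem.1 ht
  rcases hd with rfl | rfl <;> rcases hd' with rfl | rfl <;>
    simp only [replaceArc_self, replaceArc_rev hr] at h
  · exact Or.inl ⟨rfl, hδ.injOn ht hs h.symm⟩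
  · exact Or.inr ⟨rfl, by linarith [hδ.injOn hs ht' h]⟩
  · exact Or.inr ⟨(hr.1 _).symm, (hδ.injOn hs' ht h).symm⟩
  · exact Or.inl ⟨rfl, by linarith [hδ.injOn hs' ht' h]⟩

theorem isTransverse_of_eq (hδ : IsDetourArc rev γ d₀ δ) (hr : IsPairing rev)
    (hd : d ∈ ({d₀, rev d₀} : Set D)) (hd' : d' ∉ ({d₀, rev d₀} : Set D))
    (hs : s ∈ Ioo (0 : ℝ) 1) (ht : t ∈ Icc (0 : ℝ) 1)
    (h : replaceArc rev γ d₀ δ d s = replaceArc rev γ d₀ δ d' t) :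
    t ∈ Ioo (0 : ℝ) 1 ∧
      IsTransverse (replaceArc rev γ d₀ δ d) s (replaceArc rev γ d₀ δ d') t := by
  rw [replaceArc_of_notMem hd'] at h ⊢
  rcases hd with rfl | rfl
  · rw [replaceArc_self] at h ⊢
    exact hδ.transverse d' s hs t ht h
  · rw [replaceArc_rev hr] at h ⊢
    exact (hδ.transverse d' _ (Ioo.one_sub_mem hs) t ht h).imp_right
      IsTransverse.reverse

theorem sameParam_of_eq_of_eq (hδ : IsDetourArc rev γ d₀ δ) (hr : IsPairing rev)
    (hd : d ∈ ({d₀, rev d₀} : Set D)) (hd' : d' ∉ ({d₀, rev d₀} : Set D))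
    (hd'' : d'' ∉ ({d₀, rev d₀} : Set D))
    (hs : s ∈ Ioo (0 : ℝ) 1) (ht : t ∈ Ioo (0 : ℝ) 1) (hu : u ∈ Ioo (0 : ℝ) 1)
    (h' : replaceArc rev γ d₀ δ d s = replaceArc rev γ d₀ δ d' t)
    (h'' : replaceArc rev γ d₀ δ d s = replaceArc rev γ d₀ δ d'' u) :
    SameParam rev d' t d'' u := by
  rw [replaceArc_of_notMem hd'] at h'
  rw [replaceArc_of_notMem hd''] at h''
  by_contra hne
  have hcross : IsCrossing rev γ d' d'' (replaceArc rev γ d₀ δ d s) :=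
    ⟨t, ht, u, hu, h'.symm, h''.symm, hne⟩
  rcases hd with rfl | rfl
  · exact hδ.not_isCrossing _ _ s hs (by rwa [replaceArc_self] at hcross)
  · rw [replaceArc_rev hr] at hcross
    exact hδ.not_isCrossing _ _ _ (Ioo.one_sub_mem hs) hcross

theorem isArcSystem (hδ : IsDetourArc rev γ d₀ δ) (hr : IsPairing rev)
    (h : IsArcSystem rev glue γ) : IsArcSystem rev glue (replaceArc rev γ d₀ δ) where
  regular d := by
    by_cases hd : d ∈ ({d₀, rev d₀} : Set D)
    · rcases hd with rfl | rfl
      · rw [replaceArc_self]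
        exact hδ.regular
      · rw [replaceArc_rev hr]
        exact hδ.regular.reverse
    · rw [replaceArc_of_notMem hd]
      exact h.regular d
  reverse d t ht := by
    by_cases hd : d ∈ ({d₀, rev d₀} : Set D)
    · rcases hd with rfl | rfl
      · rw [replaceArc_rev hr, replaceArc_self]
      · simp only [hr.1, replaceArc_rev hr, replaceArc_self, sub_sub_cancel]
    · rw [replaceArc_of_notMem hd, replaceArc_of_notMem (mt hr.apply_mem_pair_iff.1 hd),
        h.reverse d t ht]
  joint d d' := by
    rw [hδ.replaceArc_zero hr, hδ.replaceArc_zero hr, h.joint]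
  ends d d' t ht heq := by
    have h0 : (0 : ℝ) ∈ Icc (0 : ℝ) 1 := left_mem_Icc.2 zero_le_one
    by_cases hd' : d' ∈ ({d₀, rev d₀} : Set D)
    · by_cases hd : d ∈ ({d₀, rev d₀} : Set D)
      · rcases hδ.sameParam_of_eq hr hd hd' h0 (Ioo_subset_Icc_self ht) heq with
          ⟨-, rfl⟩ | ⟨-, rfl⟩
        · exact ht.1.false
        · exact (ht.2.trans_eq (sub_zero 1).symm).false
      · exact (hδ.isTransverse_of_eq hr hd' hd ht h0 heq.symm).1.1.false
    · rw [hδ.replaceArc_zero hr, replaceArc_of_notMem hd'] at heq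
      exact h.ends d d' t ht heq

theorem no_triple (hδ : IsDetourArc rev γ d₀ δ) (hr : IsPairing rev)
    (h : IsGenericSystem rev glue γ) (hs : s ∈ Ioo (0 : ℝ) 1) (ht : t ∈ Ioo (0 : ℝ) 1)
    (hu : u ∈ Ioo (0 : ℝ) 1) (h' : replaceArc rev γ d₀ δ d s = replaceArc rev γ d₀ δ d' t)
    (h'' : replaceArc rev γ d₀ δ d s = replaceArc rev γ d₀ δ d'' u) :
    SameParam rev d s d' t ∨ SameParam rev d s d'' u ∨ SameParam rev d' t d'' u := by
  have hs' := Ioo_subset_Icc_self hs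
  have ht' := Ioo_subset_Icc_self ht
  have hu' := Ioo_subset_Icc_self hu
  have hboth := h'.symm.trans h''
  by_cases hd : d ∈ ({d₀, rev d₀} : Set D) <;> by_cases hd' : d' ∈ ({d₀, rev d₀} : Set D) <;>
    by_cases hd'' : d'' ∈ ({d₀, rev d₀} : Set D)
  · exact Or.inl (hδ.sameParam_of_eq hr hd hd' hs' ht' h')
  · exact Or.inl (hδ.sameParam_of_eq hr hd hd' hs' ht' h')
  · exact Or.inr (Or.inl (hδ.sameParam_of_eq hr hd hd'' hs' hu' h''))
  · exact Or.inr (Or.inr (hδ.sameParam_of_eq_of_eq hr hd hd' hd'' hs ht hu h' h''))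
  · exact Or.inr (Or.inr (hδ.sameParam_of_eq hr hd' hd'' ht' hu' hboth))
  · exact Or.inr (Or.inl (hδ.sameParam_of_eq_of_eq hr hd' hd hd'' ht hs hu h'.symm hboth))
  · exact Or.inl (hδ.sameParam_of_eq_of_eq hr hd'' hd hd' hu hs ht h''.symm hboth.symm)
  · simp only [replaceArc_of_notMem hd, replaceArc_of_notMem hd', replaceArc_of_notMem hd'']
      at h' h''
    exact h.no_triple d d' d'' s hs t ht u hu h' h''

theorem finite_isCrossing [Finite D] (hδ : IsDetourArc rev γ d₀ δ) (hr : IsPairing rev)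
    (h : IsGenericSystem rev glue γ) :
    {p | ∃ d d', IsCrossing rev (replaceArc rev γ d₀ δ) d d' p}.Finite := by
  refine (h.finite.union (finite_iUnion hδ.finite_inter)).subset ?_
  rintro p ⟨d, d', s, hs, t, ht, hsp, htp, hne⟩
  have hs' := Ioo_subset_Icc_self hs
  have ht' := Ioo_subset_Icc_self ht
  have hnew : ∀ {d d' s t}, d ∈ ({d₀, rev d₀} : Set D) → d' ∉ ({d₀, rev d₀} : Set D) →
      s ∈ Icc (0 : ℝ) 1 → t ∈ Icc (0 : ℝ) 1 → replaceArc rev γ d₀ δ d s = p →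
      replaceArc rev γ d₀ δ d' t = p → p ∈ ⋃ d, δ '' Icc 0 1 ∩ γ d '' Icc 0 1 := by
    intro d d' s t hd hd' hs ht hsp htp
    rw [replaceArc_of_notMem hd'] at htp
    have hmem := mem_image_of_mem (replaceArc rev γ d₀ δ d) hs
    rw [image_replaceArc hr hd, hsp] at hmem
    exact mem_iUnion.2 ⟨d', hmem, t, ht, htp⟩
  by_cases hd : d ∈ ({d₀, rev d₀} : Set D) <;> by_cases hd' : d' ∈ ({d₀, rev d₀} : Set D)
  · exact absurd (hδ.sameParam_of_eq hr hd hd' hs' ht' (hsp.trans htp.symm)) hne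
  · exact Or.inr (hnew hd hd' hs' ht' hsp htp)
  · exact Or.inr (hnew hd' hd ht' hs' htp hsp)
  · rw [replaceArc_of_notMem hd] at hsp
    rw [replaceArc_of_notMem hd'] at htp
    exact Or.inl ⟨d, d', s, hs, t, ht, hsp, htp, hne⟩

theorem isGenericSystem [Finite D] (hδ : IsDetourArc rev γ d₀ δ) (hr : IsPairing rev)
    (h : IsGenericSystem rev glue γ) : IsGenericSystem rev glue (replaceArc rev γ d₀ δ) where
  toIsArcSystem := hδ.isArcSystem hr h.toIsArcSystem
  transverse d d' s hs t ht heq := by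
    have hs' := Ioo_subset_Icc_self hs
    have ht' := Ioo_subset_Icc_self ht
    by_cases hd : d ∈ ({d₀, rev d₀} : Set D) <;> by_cases hd' : d' ∈ ({d₀, rev d₀} : Set D)
    · exact Or.inl (hδ.sameParam_of_eq hr hd hd' hs' ht' heq)
    · exact Or.inr (hδ.isTransverse_of_eq hr hd hd' hs ht' heq).2
    · exact Or.inr (hδ.isTransverse_of_eq hr hd' hd ht hs' heq.symm).2.symm
    · rw [replaceArc_of_notMem hd, replaceArc_of_notMem hd'] at heq ⊢
      exact h.transverse d d' s hs t ht heq
  no_triple _ _ _ _ hs _ ht _ hu h' h'' := hδ.no_triple hr h hs ht hu h' h''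
  finite := hδ.finite_isCrossing hr h

end IsDetourArc

end IsDetourArc

section GenericCorner

open MeasureTheory Module

variable {D P : Type*} [NormedAddCommGroup P] [NormedSpace ℝ P] {rev glue : Equiv.Perm D}
  {γ γ' : D → ℝ → P} {d₀ : D} {p q m : P}

theorem finite_brokenArc_inter_image {γ : ℝ → P} (hγ : IsPiecewiseRegular γ)
    (hp : MeetsLineTransversely γ p m) (hq : MeetsLineTransversely γ q m) :
    (brokenArc p m q '' Icc 0 1 ∩ γ '' Icc 0 1).Finite := by
  refine (((hp.finite hγ.continuousOn).union (hq.finite hγ.continuousOn)).image γ).subset ?_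
  rintro _ ⟨⟨s, -, hs⟩, t, ht, rfl⟩
  have hline := brokenArc_mem_affineSpan_pair p m q s
  rw [hs] at hline
  exact ⟨t, hline.imp (⟨ht, ·⟩) (⟨ht, ·⟩), rfl⟩

theorem brokenArc_ne_of_notMem_affineSpan_pair {x : P} {s : ℝ} (hpx : x ≠ p) (hqx : x ≠ q)
    (hp : m ∉ line[ℝ, p, x]) (hq : m ∉ line[ℝ, q, x]) : brokenArc p m q s ≠ x := by
  rintro rfl
  rcases brokenArc_mem_affineSpan_pair p m q s with h | h
  · exact hp (mem_affineSpan_pair_exchange h hpx)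
  · exact hq (mem_affineSpan_pair_exchange h hqx)

theorem IsGenericSystem.ne_of_isCrossing (h : IsGenericSystem rev glue γ) {d d' : D} {x : P}
    (hx : IsCrossing rev γ d d' x) (k : D) : x ≠ γ k 0 := by
  obtain ⟨s, hs, -, -, rfl, -⟩ := hx
  exact (h.ends k d s hs).symm

section Measure

variable [MeasurableSpace P] [BorelSpace P] {μ : Measure P} [μ.IsAddHaarMeasure]

theorem IsGenericSystem.ae_meetsLineTransversely [Finite D] (hP : 1 < finrank ℝ P)
    (h : IsGenericSystem rev glue γ) (k : D) :
    ∀ᵐ m ∂μ, ∀ d, MeetsLineTransversely (γ d) (γ k 0) m :=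
  Filter.eventually_all.2 fun d => (h.regular d).ae_meetsLineTransversely hP (h.ends k d)

theorem IsGenericSystem.ae_notMem_affineSpan_pair_of_isCrossing (hP : 1 < finrank ℝ P)
    (h : IsGenericSystem rev glue γ) (p : P) :
    ∀ᵐ m ∂μ, ∀ x ∈ {x | ∃ d d', IsCrossing rev γ d d' x}, m ∉ line[ℝ, p, x] :=
  (ae_ball_iff h.finite.countable).2 fun x _ => ae_notMem_affineSpan_pair hP p x

theorem IsGenericSystem.ae_isDetourArc_brokenArc [Finite D] (hP : 1 < finrank ℝ P)
    (h : IsGenericSystem rev glue γ) (hne : γ d₀ 0 ≠ γ (rev d₀) 0) :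
    ∀ᵐ m ∂μ, IsDetourArc rev γ d₀ (brokenArc (γ d₀ 0) m (γ (rev d₀) 0)) := by
  have hoff : ∀ᵐ m ∂μ, ∀ d, m ∉ γ d '' Icc 0 1 :=
    Filter.eventually_all.2 fun d => (h.regular d).ae_notMem_image hP
  filter_upwards [ae_notMem_affineSpan_pair hP (γ d₀ 0) (γ (rev d₀) 0), hoff,
    h.ae_meetsLineTransversely hP d₀, h.ae_meetsLineTransversely hP (rev d₀),
    h.ae_notMem_affineSpan_pair_of_isCrossing hP (γ d₀ 0),
    h.ae_notMem_affineSpan_pair_of_isCrossing hP (γ (rev d₀) 0)]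
    with m hm hoff hmeet₀ hmeet₁ hcross₀ hcross₁
  have hm₀ : m ≠ γ d₀ 0 := fun he => hm (he ▸ left_mem_affineSpan_pair ℝ _ _)
  have hm₁ : m ≠ γ (rev d₀) 0 := fun he => hm (he ▸ right_mem_affineSpan_pair ℝ _ _)
  exact
    { regular := isPiecewiseRegular_brokenArc hm₀ hm₁
      injOn := (brokenArc_injective
        (linearIndependent_sub_of_notMem_affineSpan_pair hne hm)).injOn
      zero := brokenArc_zero ..
      one := brokenArc_one ..
      transverse := fun d _ hs _ ht =>
        (hmeet₀ d).isTransverse_brokenArc (hmeet₁ d) (hoff d) hm₀ hm₁ hs ht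
      not_isCrossing := fun d d' s _ hx =>
        brokenArc_ne_of_notMem_affineSpan_pair (h.ne_of_isCrossing hx d₀)
          (h.ne_of_isCrossing hx (rev d₀)) (hcross₀ _ ⟨d, d', hx⟩) (hcross₁ _ ⟨d, d', hx⟩) rfl
      finite_inter := fun d =>
        finite_brokenArc_inter_image (h.regular d) (hmeet₀ d) (hmeet₁ d) }

end Measure

theorem IsGenericSystem.exists_common_isDetourArc [Finite D] (hP : 1 < finrank ℝ P)
    (hr : IsPairing rev) (h : IsGenericSystem rev glue γ) (h' : IsGenericSystem rev glue γ')
    (hzero : γ' d₀ 0 = γ d₀ 0) (hone : γ' (rev d₀) 0 = γ (rev d₀) 0) (hd₀ : glue d₀ ≠ rev d₀) :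
    ∃ δ, IsDetourArc rev γ d₀ δ ∧ IsDetourArc rev γ' d₀ δ := by
  have : FiniteDimensional ℝ P := .of_finrank_pos (zero_lt_one.trans hP)
  let : MeasurableSpace P := borel P
  have : BorelSpace P := ⟨rfl⟩
  have hne : γ d₀ 0 ≠ γ (rev d₀) 0 := fun he =>
    ((h.joint _ _).1 he).elim (hr.2 d₀) hd₀.symm
  have hae := h.ae_isDetourArc_brokenArc (μ := Measure.addHaar) hP hne
  have hae' := h'.ae_isDetourArc_brokenArc (μ := Measure.addHaar) hP (by rwa [hzero, hone])
  rw [hzero, hone] at hae'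
  obtain ⟨m, hm, hm'⟩ := (hae.and hae').exists
  exact ⟨_, hm, hm'⟩

end GenericCorner

section Crossing

variable {D X : Type*} {rev : Equiv.Perm D} {γ : D → ℝ → X} {d d' : D} {p : X}

theorem IsCrossing.symm (hr : IsPairing rev) (h : IsCrossing rev γ d d' p) :
    IsCrossing rev γ d' d p := by
  obtain ⟨s, hs, t, ht, hsp, htp, hne⟩ := h
  exact ⟨t, ht, s, hs, htp, hsp, mt (SameParam.symm hr) hne⟩

theorem isCrossing_sumElim_inl_iff {n : ℕ} {τ σ : ClosurePerm n}
    {strand arc : Fin (2 * n) → ℝ → X} {i j : Fin (2 * n)} :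
    IsCrossing (closureRev τ σ) (Sum.elim strand arc) (Sum.inl i) (Sum.inl j) p ↔
      IsCrossing τ.1 strand i j p := by
  simp only [IsCrossing, SpaceClosure.sameParam_inl_iff, Sum.elim_inl]

theorem replaceArc_sumElim_inr {ι κ : Type*} [DecidableEq ι] [DecidableEq κ]
    (τ : Equiv.Perm ι) (σ : Equiv.Perm κ) (strand : ι → ℝ → X) (arc : κ → ℝ → X) (i : κ)
    (δ : ℝ → X) :
    replaceArc (τ.sumCongr σ) (Sum.elim strand arc) (Sum.inr i) δ =
      Sum.elim strand (replaceArc σ arc i δ) := by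
  simp only [replaceArc, Equiv.Perm.sumCongr_apply, Sum.map_inr, Sum.update_elim_inr]

end Crossing

namespace LinkoidDiagram

open Module

variable {P : Type*} [NormedAddCommGroup P] [NormedSpace ℝ P] {n : ℕ} {τ σ : ClosurePerm n}
  {L : LinkoidDiagram P τ} {arc arc' : Fin (2 * n) → ℝ → P}

/-- The arcs `arc i`, from `i` to `σ i`, are in general position to `L` and to each other, so that
they are the closure arcs of a closure diagram of `L`. -/
abbrev IsClosureArcs (L : LinkoidDiagram P τ) (σ : ClosurePerm n)
    (arc : Fin (2 * n) → ℝ → P) : Prop :=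
  IsGenericSystem (closureRev τ σ) (closureGlue n) (Sum.elim L.strand arc)

/-- The crossings in which a closure arc takes part. -/
def closureCrossings (L : LinkoidDiagram P τ) (σ : ClosurePerm n)
    (arc : Fin (2 * n) → ℝ → P) : Set P :=
  {p | ∃ i d, IsCrossing (closureRev τ σ) (Sum.elim L.strand arc) (Sum.inr i) d p}

theorem exists_isCrossing_sumElim_iff {p : P} :
    (∃ d d', IsCrossing (closureRev τ σ) (Sum.elim L.strand arc) d d' p) ↔
      (∃ ℓ, (p, ℓ) ∈ L.classical) ∨ p ∈ L.closureCrossings σ arc := by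
  have hL := L.crossingData.crossing_iff p
  rw [mem_empty_iff_false, or_false] at hL
  rw [← hL]
  constructor
  · rintro ⟨i | i, j | j, hc⟩
    · exact Or.inl ⟨i, j, isCrossing_sumElim_inl_iff.1 hc⟩
    · exact Or.inr ⟨j, Sum.inl i, hc.symm (SpaceClosure.pairing_closureRev τ σ)⟩
    · exact Or.inr ⟨i, _, hc⟩
    · exact Or.inr ⟨i, _, hc⟩
  · rintro (⟨i, j, hc⟩ | ⟨i, d, hc⟩)
    · exact ⟨_, _, isCrossing_sumElim_inl_iff.2 hc⟩
    · exact ⟨_, _, hc⟩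

theorem IsClosureArcs.notMem_closureCrossings (h : L.IsClosureArcs σ arc) {p : P}
    {ℓ : Submodule ℝ P} (hp : (p, ℓ) ∈ L.classical) : p ∉ L.closureCrossings σ arc := by
  rintro ⟨k, -, u, hu, -, -, hup, -, -⟩
  obtain ⟨i, j, s, hs, t, ht, hsp, htp, hne⟩ :=
    (L.crossingData.crossing_iff p).2 (Or.inl ⟨ℓ, hp⟩)
  rcases h.no_triple (Sum.inl i) (Sum.inl j) (Sum.inr k) s hs t ht u hu (hsp.trans htp.symm)
    (hsp.trans hup.symm) with hsame | hsame | hsame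
  · exact hne (SpaceClosure.sameParam_inl_iff.1 hsame)
  · simp [SameParam] at hsame
  · simp [SameParam] at hsame

theorem IsClosureArcs.isPresentation (h : L.IsClosureArcs σ arc) :
    IsPresentation (closureRev τ σ) (closureGlue n) (Sum.elim L.strand arc)
      (⋃ d, Sum.elim L.strand arc d '' Icc 0 1) L.classical (L.closureCrossings σ arc) where
  pairing_rev := SpaceClosure.pairing_closureRev τ σ
  pairing_glue := SpaceClosure.pairing_closureGlue n
  generic := h
  carrier_eq := rfl
  crossingData :=
    { crossing_iff := fun _ => exists_isCrossing_sumElim_iff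
      not_both := fun _ _ => h.notMem_closureCrossings
      over_unique := L.crossingData.over_unique
      over_tangent := fun p ℓ hp =>
        let ⟨i, hi⟩ := L.crossingData.over_tangent p ℓ hp
        ⟨Sum.inl i, hi⟩ }

/-- The closure diagram of `L` with given closure arcs. -/
def closure (L : LinkoidDiagram P τ) (σ : ClosurePerm n) (arc : Fin (2 * n) → ℝ → P)
    (h : L.IsClosureArcs σ arc) : VirtualDiagram P where
  carrier := ⋃ d, Sum.elim L.strand arc d '' Icc 0 1
  classical := L.classical
  virt := L.closureCrossings σ arc
  exists_curves := ⟨_, inferInstance, _, _, _, h.isPresentation⟩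

theorem IsClosureDiagram.exists_eq_closure {D : VirtualDiagram P}
    (hD : L.IsClosureDiagram σ D) : ∃ arc h, D = L.closure σ arc h := by
  obtain ⟨arc, h, hcarrier, hclassical, hvirt⟩ := hD
  refine ⟨arc, h, ?_⟩
  cases D
  simp only at hcarrier hclassical hvirt
  subst hcarrier hclassical hvirt
  simp only [closure, closureCrossings, iUnion_sum, Sum.elim_inl, Sum.elim_inr]

theorem IsClosureArcs.apply_zero (h : L.IsClosureArcs σ arc) (i : Fin (2 * n)) :
    arc i 0 = L.strand i 0 :=
  (h.joint (Sum.inr i) (Sum.inl i)).2 (Or.inr rfl)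

theorem IsClosureArcs.apply_one (h : L.IsClosureArcs σ arc) (i : Fin (2 * n)) :
    arc i 1 = L.strand (σ.1 i) 0 := by
  have hrev := h.reverse (Sum.inr i) 0 (left_mem_Icc.2 zero_le_one)
  rw [sub_zero] at hrev
  exact hrev.symm.trans (h.apply_zero (σ.1 i))

theorem IsClosureArcs.replaceArc (h : L.IsClosureArcs σ arc) {i : Fin (2 * n)} {δ : ℝ → P}
    (hδ : IsDetourArc (closureRev τ σ) (Sum.elim L.strand arc) (Sum.inr i) δ) :
    L.IsClosureArcs σ (replaceArc σ.1 arc i δ) := by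
  rw [IsClosureArcs, ← replaceArc_sumElim_inr]
  exact hδ.isGenericSystem (SpaceClosure.pairing_closureRev τ σ) h

theorem link_closure_eq_of_eqOn_compl_pair (h : L.IsClosureArcs σ arc)
    (h' : L.IsClosureArcs σ arc') {i : Fin (2 * n)} (heq : EqOn arc arc' {i, σ.1 i}ᶜ) :
    (L.closure σ arc h).link = (L.closure σ arc' h').link := by
  refine Quot.sound (VirtualMove.detour ⟨_, inferInstance, _, _, _, _, Sum.inr i,
    h.isPresentation, h'.isPresentation, ?_, ?_, ?_, rfl,
    fun d p hp => ⟨i, d, hp⟩, fun d p hp => ⟨i, d, hp⟩⟩)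
  · rintro (d | d) hd hd' t -
    · rfl
    · have hmem : d ∉ ({i, σ.1 i} : Set _) := by
        rintro (rfl | rfl)
        · exact hd rfl
        · exact hd' rfl
      exact (congrFun (heq hmem) t).symm
  · exact (h'.apply_zero i).trans (h.apply_zero i).symm
  · exact (h'.apply_one i).trans (h.apply_one i).symm

theorem link_closure_eq_of_forall_notMem (hP : 1 < finrank ℝ P) (S : Finset (Fin (2 * n)))
    (h : L.IsClosureArcs σ arc) (h' : L.IsClosureArcs σ arc') (heq : ∀ i ∉ S, arc i = arc' i) :
    (L.closure σ arc h).link = (L.closure σ arc' h').link := by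
  induction S using Finset.induction_on generalizing arc arc' with
  | empty =>
    obtain rfl : arc = arc' := funext fun i => heq i (Finset.notMem_empty i)
    rfl
  | insert i S _ ih =>
    obtain ⟨δ, hδ, hδ'⟩ := IsGenericSystem.exists_common_isDetourArc (d₀ := Sum.inr i) hP
      (SpaceClosure.pairing_closureRev τ σ) h h'
      ((h'.apply_zero i).trans (h.apply_zero i).symm)
      ((h'.apply_zero (σ.1 i)).trans (h.apply_zero (σ.1 i)).symm) (by simp)
    rw [link_closure_eq_of_eqOn_compl_pair h (h.replaceArc hδ)
        fun k hk => (replaceArc_of_notMem hk).symm,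
      link_closure_eq_of_eqOn_compl_pair h' (h'.replaceArc hδ')
        fun k hk => (replaceArc_of_notMem hk).symm]
    refine ih (h.replaceArc hδ) (h'.replaceArc hδ') fun k hk => ?_
    by_cases hki : k ∈ ({i, σ.1 i} : Set _)
    · rcases hki with rfl | rfl
      · rw [replaceArc_self, replaceArc_self]
      · rw [replaceArc_rev σ.2, replaceArc_rev σ.2]
    · rw [replaceArc_of_notMem hki, replaceArc_of_notMem hki]
      exact heq k fun hmem => (Finset.mem_insert.1 hmem).elim (fun he => hki (Or.inl he)) hk

theorem IsClosureDiagram.link_eq (hP : 1 < finrank ℝ P) {D D' : VirtualDiagram P}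
    (hD : L.IsClosureDiagram σ D) (hD' : L.IsClosureDiagram σ D') : D.link = D'.link := by
  obtain ⟨arc, h, rfl⟩ := hD.exists_eq_closure
  obtain ⟨arc', h', rfl⟩ := hD'.exists_eq_closure
  exact link_closure_eq_of_forall_notMem hP Finset.univ h h' fun i hi =>
    absurd (Finset.mem_univ i) hi

end LinkoidDiagram

theorem finrank_normalPlane (ξ : Direction) : Module.finrank ℝ (normalPlane ξ) = 2 :=
  have : Fact (Module.finrank ℝ Space = 2 + 1) := ⟨by simp⟩
  Submodule.finrank_orthogonal_span_singleton (ne_zero_of_mem_unit_sphere ξ)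

theorem SpaceClosure.isClosureDiagram_projection {n : ℕ} {τ σ : ClosurePerm n} {L : OpenCurves τ}
    (K : SpaceClosure L σ) {ξ : Direction} (hL : L.IsRegular ξ) (hK : K.IsRegular ξ) :
    (L.projection ξ hL).IsClosureDiagram σ (K.projection ξ hK) := by
  have hcurve : K.projCurve ξ =
      Sum.elim (L.projection ξ hL).strand (fun i t => projAlong ξ (K.arc i t)) := by
    funext d
    rcases d with d | d <;> rfl
  refine ⟨fun i t => projAlong ξ (K.arc i t), hcurve ▸ hK, ?_, rfl, ?_⟩
  · simp only [SpaceClosure.projection, iUnion_sum]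
    rfl
  · rw [← hcurve]
    rfl

theorem corollary6p1 {n : ℕ} {τ σ : ClosurePerm n} (L : OpenCurves τ) (ξ : Direction)
    (hL : L.IsRegular ξ) (K : SpaceClosure L σ) (hK : K.IsRegular ξ) :
    (L.projection ξ hL).IsClosureDiagram σ (K.projection ξ hK) ∧
      (L.projection ξ hL).IsVirtualClosure σ (K.projection ξ hK).link := by
  have h := K.isClosureDiagram_projection hL hK
  have hplane : 1 < Module.finrank ℝ (normalPlane ξ) := by
    rw [finrank_normalPlane]
    exact one_lt_two
  exact ⟨h, ⟨_, h, rfl⟩, fun D hD => hD.link_eq hplane h⟩
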